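/- Work in first-order logic with equality over the language of arithmetic $\{0,\mathsf s,+,\times,<\}$, with formulae in De Morgan normal form (negation only on atoms; $\neg\phi$ denotes the De Morgan dual and $\phi\supset\psi$ is $\neg\phi\vee\psi$). $T\vdash\phi$ means that $\phi$ is a logical consequence of $T$, free variables of $\phi$ being read universally. *Hierarchy.* $\forall x<t.\,\phi$ and $\exists x<t.\,\phi$ ($x$ not in $t$) abbreviate $\forall x(x<t\supset\phi)$ and $\exists x(x<t\wedge\phi)$. $\Sigma_0=\Pi_0$ is the class of bounded formulae, i.e. those whose only quantifiers are of this form. $\Sigma_{n+1}$ consists of the formulae $\exists\vec x.\,\phi$ with $\phi\in\Pi_n$, and $\Pi_{n+1}$ of the formulae $\forall\vec x.\,\phi$ with $\phi\in\Sigma_n$ (the block $\vec x$ may be empty). *Inductive theories.* $\mathsf Q$ is Robinson arithmetic: the universal closures of $\mathsf sx\ne0$; $\mathsf sx=\mathsf sy\supset x=y$; $x\ne0\supset\exists y.\,x=\mathsf sy$; $x+0=x$; $x+\mathsf sy=\mathsf s(x+y)$; $x\cdot0=0$; $x\cdot\mathsf sy=x\cdot y+x$; and $x<y\equiv\exists z.\,x+\mathsf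 sz=y$. $I\Sigma_n$ is $\mathsf Q$ together with the universal closures of $(\phi(0)\wedge\forall x(\phi(x)\supset\phi(\mathsf sx)))\supset\forall x\,\phi(x)$ for $\phi\in\Sigma_n$. *Sequent calculus.* A sequent $\Gamma\Rightarrow\Delta$ consists of two finite sets of formulae. It expresses $\bigwedge\Gamma\supset\bigvee\Delta$. The initial sequents are - $\Gamma,\phi\Rightarrow\Delta,\phi$; $\ \Gamma,\phi,\neg\phi\Rightarrow\Delta$; $\ \Gamma\Rightarrow\Delta,\phi,\neg\phi$; $\ \Gamma\Rightarrow\Delta,t=t$; - $\Gamma,s_1=t_1,\dots,s_k=t_k\Rightarrow\Delta,f(\vec s)=f(\vec t)$ for each function symbol $f$; - $\Gamma,s_1=t_1,s_2=t_2,P(s_1,s_2)\Rightarrow\Delta,P(t_1,t_2)$ for $P\in\{=,<\}$; - $\Gamma\Rightarrow\Delta,A$ for each substitution instance $A$ of the following bounded forms of the axioms of $\mathsf Q$: the quantifier-free ones as above, $x\neq0\supset\exists y<x.\,x=\mathsf sy$, $\ x<y\supset\exists z<y.\,x+\mathsf sz=y$ and $x+\mathsf sz=y\supset x<y$. The rules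 are weakening, cut, substitution ($\theta$-$\mathit{sub}$: from $\Gamma\Rightarrow\Delta$ infer $\theta(\Gamma)\Rightarrow\theta(\Delta)$, for a map $\theta$ from variables to terms) and the usual left and right rules for $\vee,\wedge,\exists,\forall$, where the eigenvariable of $\exists$-left and $\forall$-right does not occur free in the conclusion of the step. *Cyclic proofs.* A preproof is a possibly infinite tree of locally correct inference steps in this calculus. It is regular if it is the unfolding of a finite labelled directed graph. Let $(\Gamma_i\Rightarrow\Delta_i)_{i\ge0}$ be an infinite branch. A term $t'$ is a precursor of a term $t$ at $i$ if either $\Gamma_i\Rightarrow\Delta_i$ concludes a $\theta$-$\mathit{sub}$ step and $t=\theta(t')$, or it concludes any other step and $t'$ is $t$ or the formula $t'=t$ is in $\Gamma_i$. A trace along the branch is a sequence of terms $(t_i)_{i\ge m}$, for some $m$, such that for every $i\ge m$ the term $t_i$ occurs (with none of its variables bound) in $\Gamma_i\Rightarrow\Delta_i$ and either (a) $t_{i+1}$ is a precursor of $t_i$ at $i$, or (b) some formula $t_{i+1}<t$ is in $\Gamma_{i+1}$, where $t$ is a precursor of $t_i$ at $i$; in case (b) the trace progresses at $i+1$. A cyclic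 proof is a regular preproof in which every infinite branch has a trace that progresses infinitely often. $C\Sigma_n$ is the theory axiomatised by the universal closures of the conclusions of those cyclic proofs in which all formulae are in $\Sigma_n$. **Theorem.** Let $n\ge0$ and let $\phi$ be a $\Pi_{n+1}$ formula. If $I\Sigma_{n+1}\vdash\phi$, then $C\Sigma_n\vdash\phi$. -/

import Mathlib

namespace CyclicArith

/-! ## The language of arithmetic `{0, succ, +, ×, <}` -/

inductive Func : ℕ → Type
  | zero : Func 0
  | succ : Func 1
  | add : Func 2
  | mul : Func 2

inductive Pred : ℕ → Type
  | lt : Pred 2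

/-- The language of arithmetic (equality is a logical symbol). -/
abbrev arith : FirstOrder.Language.{0, 0} := ⟨Func, Pred⟩

/-- Terms, with variables `0, 1, 2, …`. -/
abbrev Tm : Type := arith.Term ℕ

def v (n : ℕ) : Tm := FirstOrder.Language.Term.var n
def zero : Tm := FirstOrder.Language.Term.func Func.zero ![]
def succ (t : Tm) : Tm := FirstOrder.Language.Term.func Func.succ ![t]
def add (s t : Tm) : Tm := FirstOrder.Language.Term.func Func.add ![s, t]
def mul (s t : Tm) : Tm := FirstOrder.Language.Term.func Func.mul ![s, t]

/-- Renaming of every variable `n` to `n + 1`, used when a term is put below a quantifier. -/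
def lift (t : Tm) : Tm := t.relabel Nat.succ

/-! ## Formulae in De Morgan normal form

Bound variables are de Bruijn indices: in `all φ` and `ex φ` the variable `0` of `φ` is the bound
one, and the variable `n + 1` of `φ` is the variable `n` of `all φ` and `ex φ`. -/

inductive Form : Type
  | eq : Tm → Tm → Form
  | neq : Tm → Tm → Form
  | lt : Tm → Tm → Form
  | nlt : Tm → Tm → Form
  | and : Form → Form → Form
  | or : Form → Form → Form
  | all : Form → Form
  | ex : Form → Form

noncomputable instance : DecidableEq Form := Classical.decEq _

/-- `scons a f` is the sequence `a, f 0, f 1, …`. -/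
def scons {α : Type*} (a : α) (f : ℕ → α) : ℕ → α
  | 0 => a
  | n + 1 => f n

/-- Substitutions, mapping variables to terms. -/
abbrev Subst : Type := ℕ → Tm

namespace Form

/-- De Morgan dual. -/
def neg : Form → Form
  | eq s t => neq s t
  | neq s t => eq s t
  | lt s t => nlt s t
  | nlt s t => lt s t
  | and φ ψ => or φ.neg ψ.neg
  | or φ ψ => and φ.neg ψ.neg
  | all φ => ex φ.neg
  | ex φ => all φ.neg

def imp (φ ψ : Form) : Form := or φ.neg ψ

def iff (φ ψ : Form) : Form := and (imp φ ψ) (imp ψ φ)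

/-- Simultaneous (capture-avoiding) substitution. -/
def subst : Subst → Form → Form
  | θ, eq s t => eq (s.subst θ) (t.subst θ)
  | θ, neq s t => neq (s.subst θ) (t.subst θ)
  | θ, lt s t => lt (s.subst θ) (t.subst θ)
  | θ, nlt s t => nlt (s.subst θ) (t.subst θ)
  | θ, and φ ψ => and (φ.subst θ) (ψ.subst θ)
  | θ, or φ ψ => or (φ.subst θ) (ψ.subst θ)
  | θ, all φ => all (φ.subst (scons (v 0) fun n => lift (θ n)))
  | θ, ex φ => ex (φ.subst (scons (v 0) fun n => lift (θ n)))

/-- `φ[t/x]`, where `x` is the variable that the quantifier of `all φ` or `ex φ` binds. -/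
def inst (φ : Form) (t : Tm) : Form := φ.subst (scons t v)

/-- Free variables. -/
def freeVars : Form → Finset ℕ
  | eq s t | neq s t | lt s t | nlt s t => s.varFinset ∪ t.varFinset
  | and φ ψ | or φ ψ => φ.freeVars ∪ ψ.freeVars
  | all φ | ex φ => (φ.freeVars.erase 0).image Nat.pred

/-- Universal closure. -/
def closure (φ : Form) : Form := all^[φ.freeVars.sup Nat.succ] φ

/-- `∀ x < t. φ`, an abbreviation for `∀ x. (x < t ⊃ φ)`; here `x` does not occur in `t`. -/
def ballLT (t : Tm) (φ : Form) : Form := all (imp (lt (v 0) (lift t)) φ)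

/-- `∃ x < t. φ`, an abbreviation for `∃ x. (x < t ∧ φ)`; here `x` does not occur in `t`. -/
def bexLT (t : Tm) (φ : Form) : Form := ex (and (lt (v 0) (lift t)) φ)

/-- Bounded formulae. -/
inductive Bounded : Form → Prop
  | eq (s t : Tm) : Bounded (eq s t)
  | neq (s t : Tm) : Bounded (neq s t)
  | lt (s t : Tm) : Bounded (lt s t)
  | nlt (s t : Tm) : Bounded (nlt s t)
  | and {φ ψ : Form} : Bounded φ → Bounded ψ → Bounded (and φ ψ)
  | or {φ ψ : Form} : Bounded φ → Bounded ψ → Bounded (or φ ψ)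
  | ball (t : Tm) {φ : Form} : Bounded φ → Bounded (ballLT t φ)
  | bex (t : Tm) {φ : Form} : Bounded φ → Bounded (bexLT t φ)

/-- Truth of a formula in a structure under an assignment of its elements to the variables. -/
def Sat {M : Type} [arith.Structure M] : (ℕ → M) → Form → Prop
  | ρ, eq s t => s.realize ρ = t.realize ρ
  | ρ, neq s t => s.realize ρ ≠ t.realize ρ
  | ρ, lt s t => FirstOrder.Language.Structure.RelMap (L := arith) Pred.lt ![s.realize ρ, t.realize ρ]
  | ρ, nlt s t => ¬ FirstOrder.Language.Structure.RelMap (L := arith) Pred.lt ![s.realize ρ, t.realize ρ]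
  | ρ, and φ ψ => φ.Sat ρ ∧ ψ.Sat ρ
  | ρ, or φ ψ => φ.Sat ρ ∨ ψ.Sat ρ
  | ρ, all φ => ∀ a : M, φ.Sat (scons a ρ)
  | ρ, ex φ => ∃ a : M, φ.Sat (scons a ρ)

end Form

open Form

/-! ## The arithmetical hierarchy

Blocks of quantifiers may be empty, so that the classes are cumulative and closed under
subformulae. -/

mutual

/-- `Σ₀` is the class of bounded formulae, and `Σₙ₊₁` that of `∃ x₁ … ∃ xₖ. φ` with `φ` in `Πₙ`. -/
def SigmaClass : ℕ → Set Form
  | 0 => {φ | Bounded φ}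
  | n + 1 => {ψ | ∃ (k : ℕ) (φ : Form), φ ∈ PiClass n ∧ ψ = ex^[k] φ}

/-- `Π₀` is the class of bounded formulae, and `Πₙ₊₁` that of `∀ x₁ … ∀ xₖ. φ` with `φ` in `Σₙ`. -/
def PiClass : ℕ → Set Form
  | 0 => {φ | Bounded φ}
  | n + 1 => {ψ | ∃ (k : ℕ) (φ : Form), φ ∈ SigmaClass n ∧ ψ = all^[k] φ}

end

/-! ## Theories and logical consequence -/

/-- `φ` is a logical consequence of `T`. -/
def Proves (T : Set Form) (φ : Form) : Prop :=
  ∀ (M : Type) [arith.Structure M],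
    (∀ ψ ∈ T, ∀ ρ : ℕ → M, ψ.Sat ρ) → ∀ ρ : ℕ → M, φ.Sat ρ

/-- The axioms of Robinson arithmetic, without the outermost universal quantifiers. -/
inductive QMatrix : Form → Prop
  | q1 : QMatrix (neq (succ (v 0)) zero)
  | q2 : QMatrix (imp (eq (succ (v 0)) (succ (v 1))) (eq (v 0) (v 1)))
  | q3 : QMatrix (imp (neq (v 0) zero) (ex (eq (v 1) (succ (v 0)))))
  | q4 : QMatrix (eq (add (v 0) zero) (v 0))
  | q5 : QMatrix (eq (add (v 0) (succ (v 1))) (succ (add (v 0) (v 1))))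
  | q6 : QMatrix (eq (mul (v 0) zero) zero)
  | q7 : QMatrix (eq (mul (v 0) (succ (v 1))) (add (mul (v 0) (v 1)) (v 0)))
  | q8 : QMatrix (iff (lt (v 0) (v 1)) (ex (eq (add (v 1) (succ (v 0))) (v 2))))

/-- Robinson arithmetic. -/
def Q : Set Form := {ψ | ∃ φ, QMatrix φ ∧ ψ = φ.closure}

/-- `(φ(0) ∧ ∀ x. (φ(x) ⊃ φ(succ x))) ⊃ ∀ x. φ(x)`, where `x` is the variable `0` of `φ`; its other
variables are parameters. -/
def inductionAxiom (φ : Form) : Form :=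
  imp (and (φ.inst zero) (all (imp φ (φ.subst (scons (succ (v 0)) fun n => v (n + 1))))))
    (all φ)

/-- The theory `IΦ`: Robinson arithmetic with induction for the formulae in `Φ`. -/
def ITheory (Φ : Set Form) : Set Form :=
  Q ∪ {ψ | ∃ φ ∈ Φ, ψ = (inductionAxiom φ).closure}

/-- `IΣₙ`. -/
def ISigma (n : ℕ) : Set Form := ITheory (SigmaClass n)

/-! ## The sequent calculus for Robinson arithmetic -/

/-- Sequents `Γ ⇒ Δ`; cedents are finite sets. -/
@[ext]
structure Sequent : Type where
  ant : Finset Form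
  suc : Finset Form

namespace Sequent

/-- Disjunction of a list of formulae; the empty disjunction is the false formula `¬ 0 = 0`. -/
def disj : List Form → Form
  | [] => neq zero zero
  | φ :: l => or φ (disj l)

/-- The formula `⋀ Γ ⊃ ⋁ Δ` that a sequent expresses, as `⋁ ¬Γ ∨ ⋁ Δ`. -/
noncomputable def toForm (S : Sequent) : Form := disj (S.ant.toList.map neg ++ S.suc.toList)

/-- The variable `a` does not occur free in the sequent. -/
def Fresh (a : ℕ) (S : Sequent) : Prop := ∀ φ ∈ S.ant ∪ S.suc, a ∉ φ.freeVars

end Sequent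

/-- The axioms of Robinson arithmetic in bounded form, without the outermost universal quantifiers.
The existential quantifiers in positive position are bounded; the right-to-left half of the
definition of `<` has its quantifier in negative position, where it is an outermost universal
one. -/
inductive QBounded : Form → Prop
  | q1 : QBounded (neq (succ (v 0)) zero)
  | q2 : QBounded (imp (eq (succ (v 0)) (succ (v 1))) (eq (v 0) (v 1)))
  | q3 : QBounded (imp (neq (v 0) zero) (bexLT (v 0) (eq (v 1) (succ (v 0)))))
  | q4 : QBounded (eq (add (v 0) zero) (v 0))
  | q5 : QBounded (eq (add (v 0) (succ (v 1))) (succ (add (v 0) (v 1))))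
  | q6 : QBounded (eq (mul (v 0) zero) zero)
  | q7 : QBounded (eq (mul (v 0) (succ (v 1))) (add (mul (v 0) (v 1)) (v 0)))
  | q8l : QBounded (imp (lt (v 0) (v 1)) (bexLT (v 1) (eq (add (v 1) (succ (v 0))) (v 2))))
  | q8r : QBounded (imp (eq (add (v 0) (succ (v 2))) (v 1)) (lt (v 0) (v 1)))

/-- `Infers r Ps S`: there is an inference step with the premisses `Ps` and the conclusion `S`,
where `r = some θ` if the step is a `θ`-substitution and `r = none` for every other step. -/
inductive Infers : Option Subst → List Sequent → Sequent → Prop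
  | ax {A : Form} (hA : QBounded A) (θ : Subst) (Γ Δ : Finset Form) :
      Infers none [] ⟨Γ, insert (A.subst θ) Δ⟩
  | id (φ : Form) (Γ Δ : Finset Form) : Infers none [] ⟨insert φ Γ, insert φ Δ⟩
  | negL (φ : Form) (Γ Δ : Finset Form) : Infers none [] ⟨insert φ (insert φ.neg Γ), Δ⟩
  | negR (φ : Form) (Γ Δ : Finset Form) : Infers none [] ⟨Γ, insert φ (insert φ.neg Δ)⟩
  | eqRefl (t : Tm) (Γ Δ : Finset Form) : Infers none [] ⟨Γ, insert (eq t t) Δ⟩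
  | eqFunc {k : ℕ} (f : Func k) (s t : Fin k → Tm) (Γ Δ : Finset Form) :
      Infers none []
        ⟨Γ ∪ Finset.univ.image (fun i => eq (s i) (t i)),
          insert (eq (FirstOrder.Language.Term.func f s) (FirstOrder.Language.Term.func f t)) Δ⟩
  | eqEq (s₁ s₂ t₁ t₂ : Tm) (Γ Δ : Finset Form) :
      Infers none [] ⟨Γ ∪ {eq s₁ t₁, eq s₂ t₂, eq s₁ s₂}, insert (eq t₁ t₂) Δ⟩
  | eqLt (s₁ s₂ t₁ t₂ : Tm) (Γ Δ : Finset Form) :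
      Infers none [] ⟨Γ ∪ {eq s₁ t₁, eq s₂ t₂, lt s₁ s₂}, insert (lt t₁ t₂) Δ⟩
  | sub (θ : Subst) (Γ Δ : Finset Form) :
      Infers (some θ) [⟨Γ, Δ⟩] ⟨Γ.image (Form.subst θ), Δ.image (Form.subst θ)⟩
  | cut (φ : Form) (Γ Δ : Finset Form) :
      Infers none [⟨Γ, insert φ Δ⟩, ⟨insert φ Γ, Δ⟩] ⟨Γ, Δ⟩
  | wk (Γ Γ' Δ Δ' : Finset Form) : Infers none [⟨Γ, Δ⟩] ⟨Γ ∪ Γ', Δ ∪ Δ'⟩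
  | orL (φ ψ : Form) (Γ Δ : Finset Form) :
      Infers none [⟨insert φ Γ, Δ⟩, ⟨insert ψ Γ, Δ⟩] ⟨insert (or φ ψ) Γ, Δ⟩
  | orR₀ (φ ψ : Form) (Γ Δ : Finset Form) :
      Infers none [⟨Γ, insert φ Δ⟩] ⟨Γ, insert (or φ ψ) Δ⟩
  | orR₁ (φ ψ : Form) (Γ Δ : Finset Form) :
      Infers none [⟨Γ, insert ψ Δ⟩] ⟨Γ, insert (or φ ψ) Δ⟩
  | andL₀ (φ ψ : Form) (Γ Δ : Finset Form) :
      Infers none [⟨insert φ Γ, Δ⟩] ⟨insert (and φ ψ) Γ, Δ⟩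
  | andL₁ (φ ψ : Form) (Γ Δ : Finset Form) :
      Infers none [⟨insert ψ Γ, Δ⟩] ⟨insert (and φ ψ) Γ, Δ⟩
  | andR (φ ψ : Form) (Γ Δ : Finset Form) :
      Infers none [⟨Γ, insert φ Δ⟩, ⟨Γ, insert ψ Δ⟩] ⟨Γ, insert (and φ ψ) Δ⟩
  | exL (φ : Form) (a : ℕ) (Γ Δ : Finset Form) (ha : Sequent.Fresh a ⟨insert (ex φ) Γ, Δ⟩) :
      Infers none [⟨insert (φ.inst (v a)) Γ, Δ⟩] ⟨insert (ex φ) Γ, Δ⟩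
  | exR (φ : Form) (t : Tm) (Γ Δ : Finset Form) :
      Infers none [⟨Γ, insert (φ.inst t) Δ⟩] ⟨Γ, insert (ex φ) Δ⟩
  | allL (φ : Form) (t : Tm) (Γ Δ : Finset Form) :
      Infers none [⟨insert (φ.inst t) Γ, Δ⟩] ⟨insert (all φ) Γ, Δ⟩
  | allR (φ : Form) (a : ℕ) (Γ Δ : Finset Form) (ha : Sequent.Fresh a ⟨Γ, insert (all φ) Δ⟩) :
      Infers none [⟨Γ, insert (φ.inst (v a)) Δ⟩] ⟨Γ, insert (all φ) Δ⟩

/-! ## Preproofs, traces and cyclic proofs -/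

/-- A preproof: a possibly infinite tree of inference steps, presented as the unfolding from `root`
of a directed graph. Each node `x` is a step with conclusion `seq x`, whose premisses are the
conclusions of the nodes in the list `prem x`; `rule x` tells whether it is a substitution step.
A tree is such a graph, and the regular preproofs are the unfoldings of finite graphs. -/
structure Preproof : Type 1 where
  Node : Type
  root : Node
  seq : Node → Sequent
  rule : Node → Option Subst
  prem : Node → List Node
  correct : ∀ x, Infers (rule x) ((prem x).map seq) (seq x)

/-- The term `t` is a subterm of the given one. -/
def OccursInTm (t : Tm) : Tm → Prop
  | FirstOrder.Language.Term.var n => t = FirstOrder.Language.Term.var n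
  | FirstOrder.Language.Term.func f ts => t = FirstOrder.Language.Term.func f ts ∨ ∃ i, OccursInTm t (ts i)

/-- The term `t` occurs in the formula, none of its variables being bound there. -/
def Form.Occurs : Tm → Form → Prop
  | t, eq s u | t, neq s u | t, lt s u | t, nlt s u => OccursInTm t s ∨ OccursInTm t u
  | t, and φ ψ | t, or φ ψ => φ.Occurs t ∨ ψ.Occurs t
  | t, all φ | t, ex φ => φ.Occurs (lift t)

/-- The term `t` occurs in the sequent. -/
def Sequent.Occurs (t : Tm) (S : Sequent) : Prop := ∃ φ ∈ S.ant ∪ S.suc, φ.Occurs t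

namespace Preproof

variable (P : Preproof)

/-- Infinite branches. -/
def IsBranch (b : ℕ → P.Node) : Prop := b 0 = P.root ∧ ∀ i, b (i + 1) ∈ P.prem (b i)

/-- `t'` is a precursor of `t` at a step. -/
def Precursor (x : P.Node) (t' t : Tm) : Prop :=
  match P.rule x with
  | some θ => t = t'.subst θ
  | none => eq t' t ∈ (P.seq x).ant ∨ t' = t

/-- The trace `t` progresses at `i + 1`. -/
def ProgressesAt (b : ℕ → P.Node) (t : ℕ → Tm) (i : ℕ) : Prop :=
  ∃ u, P.Precursor (b i) u (t i) ∧ lt (t (i + 1)) u ∈ (P.seq (b (i + 1))).ant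

/-- `(tᵢ)` for `i ≥ n` is a trace along the branch; the terms `tᵢ` with `i < n` are irrelevant. -/
def IsTrace (b : ℕ → P.Node) (n : ℕ) (t : ℕ → Tm) : Prop :=
  ∀ i ≥ n, (P.seq (b i)).Occurs (t i) ∧
    (P.Precursor (b i) (t (i + 1)) (t i) ∨ P.ProgressesAt b t i)

/-- `∞`-proofs: each infinite branch has a trace that progresses infinitely often. -/
def IsInfProof : Prop :=
  ∀ b, P.IsBranch b → ∃ n t, P.IsTrace b n t ∧ ∀ m, ∃ i ≥ m, P.ProgressesAt b t i

/-- Cyclic proofs: regular `∞`-proofs. -/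
def IsCyclicProof : Prop := Finite P.Node ∧ P.IsInfProof

/-- Every formula that occurs in the preproof is in `Φ`. -/
def ContainsOnly (Φ : Set Form) : Prop := ∀ x, ∀ φ ∈ (P.seq x).ant ∪ (P.seq x).suc, φ ∈ Φ

end Preproof

/-- The theory `CΦ`, axiomatised by the universal closures of the conclusions of cyclic proofs that
contain only formulae in `Φ`. -/
def CTheory (Φ : Set Form) : Set Form :=
  {ψ | ∃ P : Preproof, P.IsCyclicProof ∧ P.ContainsOnly Φ ∧
    ψ = (P.seq P.root).toForm.closure}

/-- `CΣₙ`. -/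
def CSigma (n : ℕ) : Set Form := CTheory (SigmaClass n)

end CyclicArith

-- The argument is model-theoretic. Write the given formula as ∀x⃗ σ with σ in Σₙ. If the sequent ⇒
-- σ has no cyclic proof with Σₙ formulae, a term model of IΣₙ₊₁ is built in which σ fails. A
-- subtraction argument reduces Σₙ₊₁ induction to Πₙ₊₁ induction (`sat_sigma_induction`), so the
-- model only needs Q and induction for formulae ∀x⃗ σ(x⃗, y) with σ in Σₙ.
--
-- The obstacle is that ∀x⃗ σ(x⃗, t) may not occur in the proofs, so it is simulated. To assume it
-- is to allow finite graphs of inference steps with open leaves, each of which contains an instance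
-- σ(u, t) on the right, next to the side formulae (`leafSet`, `DerivesFrom`). To refute it is to
-- put some σ(u, t) on the right. A cut on ∀x⃗ σ(x⃗, t) substitutes u for the generic arguments in a
-- derivation of Γ ⇒ Δ, σ(x⃗, t) and grafts the results onto the open leaves
-- (`DerivesFrom.cut_all`).
--
-- Induction becomes a cycle (`Derives.loop`, `DerivesFrom.induction`). To derive Γ ⇒ Δ, σ(x⃗, c),
-- distinguish c = 0 from c = s c' with c' < c. In the second case the induction step gives a
-- derivation of σ(x⃗, s c') from the hypothesis ∀x⃗ σ(x⃗, c'); its leaves σ(u, c') are instances of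
-- the initial sequent with c' for c, so they lead back to it by substitution. Every round moves the
-- trace from c to c' < c. As cycles are nested, a derivation carries a set `P` of variables that
-- all its steps preserve, so that an outer trace survives the inner graphs; the equations x = x
-- keep these variables present, since a trace must consist of terms that occur.
--
-- A Henkin construction (`exists_saturated`) extends the underivable sequent so that each Σₙ
-- formula is decided, with witnesses, and for each σ and t either ∀x⃗ σ(x⃗, t) is assumed or it is
-- refuted along with the base or some step of its induction. By the truth lemma the term model then
-- satisfies Πₙ₊₁ induction.

namespace CyclicArith

open Form FirstOrder.Language

/-! ## Substitution -/

@[simp] theorem subst_v (n : ℕ) (θ : Subst) : (v n).subst θ = θ n := rfl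

theorem tm_subst_subst (t : Tm) (θ θ' : Subst) :
    (t.subst θ).subst θ' = t.subst fun n => (θ n).subst θ' := by
  induction t with
  | var n => rfl
  | func f ts ih => simp only [Term.subst, ih]

theorem tm_relabel_subst (t : Tm) (f : ℕ → ℕ) (θ : Subst) :
    (t.relabel f).subst θ = t.subst fun n => θ (f n) := by
  induction t with
  | var n => rfl
  | func g ts ih => simp only [Term.relabel, Term.subst, ih]

theorem tm_subst_relabel (t : Tm) (f : ℕ → ℕ) (θ : Subst) :
    (t.subst θ).relabel f = t.subst fun n => (θ n).relabel f := by
  induction t with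
  | var n => rfl
  | func g ts ih => simp only [Term.relabel, Term.subst, ih]

theorem tm_subst_congr {t : Tm} {θ θ' : Subst} (h : ∀ x ∈ t.varFinset, θ x = θ' x) :
    t.subst θ = t.subst θ' := by
  induction t with
  | var n => exact h n (by simp [Term.varFinset])
  | func g ts ih =>
    simp only [Term.subst]
    congr 1
    funext i
    exact ih i fun x hx => h x (by simp only [Term.varFinset, Finset.mem_biUnion]; exact ⟨i, by simp, hx⟩)

theorem tm_subst_v (t : Tm) : t.subst v = t := by
  induction t with
  | var n => rfl
  | func g ts ih => simp only [Term.subst, ih]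

/-- The substitution `θ` below a quantifier. -/
def up (θ : Subst) : Subst := scons (v 0) fun n => lift (θ n)

theorem lift_subst_up (t : Tm) (θ : Subst) : (lift t).subst (up θ) = lift (t.subst θ) := by
  simp only [lift, tm_relabel_subst, tm_subst_relabel]
  rfl

theorem lift_subst_scons (t s : Tm) (θ : Subst) : (lift t).subst (scons s θ) = t.subst θ := by
  simp only [lift, tm_relabel_subst]
  rfl

theorem up_v : up v = v := by
  funext n; cases n <;> rfl

namespace Form

theorem subst_all (φ : Form) (θ : Subst) : (all φ).subst θ = all (φ.subst (up θ)) := rfl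

theorem subst_ex (φ : Form) (θ : Subst) : (ex φ).subst θ = ex (φ.subst (up θ)) := rfl

theorem subst_subst (φ : Form) : ∀ θ θ' : Subst,
    (φ.subst θ).subst θ' = φ.subst fun n => (θ n).subst θ' := by
  have key : ∀ θ θ' : Subst,
      (fun n => (up θ n).subst (up θ')) = up fun n => (θ n).subst θ' := by
    intro θ θ'
    funext n
    cases n with
    | zero => rfl
    | succ n => exact lift_subst_up _ _
  induction φ with
  | eq s t | neq s t | lt s t | nlt s t => intro θ θ'; simp only [subst, tm_subst_subst]
  | and φ ψ ih₁ ih₂ | or φ ψ ih₁ ih₂ => intro θ θ'; simp only [subst, ih₁, ih₂]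
  | all φ ih | ex φ ih => intro θ θ'; simp only [subst_all, subst_ex, ih, key]

theorem subst_v (φ : Form) : φ.subst v = φ := by
  induction φ with
  | eq s t | neq s t | lt s t | nlt s t => simp only [subst, tm_subst_v]
  | and φ ψ ih₁ ih₂ | or φ ψ ih₁ ih₂ => simp only [subst, ih₁, ih₂]
  | all φ ih | ex φ ih => simp only [subst_all, subst_ex, up_v, ih]

theorem subst_congr {φ : Form} : ∀ {θ θ' : Subst}, (∀ x ∈ φ.freeVars, θ x = θ' x) →
    φ.subst θ = φ.subst θ' := by
  have key : ∀ {φ : Form} {θ θ' : Subst},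
      (∀ x ∈ (φ.freeVars.erase 0).image Nat.pred, θ x = θ' x) →
      ∀ x ∈ φ.freeVars, up θ x = up θ' x := by
    intro φ θ θ' h x hx
    cases x with
    | zero => rfl
    | succ x =>
      exact congrArg lift (h x (Finset.mem_image.2 ⟨x + 1, by simp [hx], rfl⟩))
  induction φ with
  | eq s t | neq s t | lt s t | nlt s t =>
    intro θ θ' h
    simp only [freeVars, Finset.mem_union] at h
    simp only [subst]
    rw [tm_subst_congr fun x hx => h x (Or.inl hx), tm_subst_congr fun x hx => h x (Or.inr hx)]
  | and φ ψ ih₁ ih₂ | or φ ψ ih₁ ih₂ =>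
    intro θ θ' h
    simp only [freeVars, Finset.mem_union] at h
    simp only [subst]
    rw [ih₁ fun x hx => h x (Or.inl hx), ih₂ fun x hx => h x (Or.inr hx)]
  | all φ ih | ex φ ih =>
    intro θ θ' h
    simp only [subst_all, subst_ex]
    rw [ih (key h)]

theorem subst_eq_self {φ : Form} {θ : Subst} (h : ∀ x ∈ φ.freeVars, θ x = v x) :
    φ.subst θ = φ := (subst_congr h).trans φ.subst_v

theorem subst_up_inst (φ : Form) (θ : Subst) (t : Tm) :
    (φ.subst (up θ)).inst t = φ.subst (scons t θ) := by
  rw [inst, subst_subst]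
  congr 1
  funext n
  cases n with
  | zero => rfl
  | succ n => exact (lift_subst_scons _ _ _).trans (tm_subst_v _)

/-- The number of connectives and quantifiers. -/
def size : Form → ℕ
  | and φ ψ | or φ ψ => φ.size + ψ.size + 1
  | all φ | ex φ => φ.size + 1
  | _ => 0

theorem size_subst (φ : Form) : ∀ θ, (φ.subst θ).size = φ.size := by
  induction φ with
  | eq s t | neq s t | lt s t | nlt s t => intro θ; rfl
  | and φ ψ ih₁ ih₂ | or φ ψ ih₁ ih₂ => intro θ; simp only [subst, size, ih₁, ih₂]
  | all φ ih | ex φ ih => intro θ; simp only [subst_all, subst_ex, size, ih]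

/-! ## Semantics -/

section Semantics

variable {M : Type} [arith.Structure M]

theorem sat_subst (φ : Form) : ∀ (θ : Subst) (ρ : ℕ → M),
    (φ.subst θ).Sat ρ ↔ φ.Sat fun n => (θ n).realize ρ := by
  have key : ∀ (θ : Subst) (ρ : ℕ → M) (a : M),
      (fun n => (up θ n).realize (scons a ρ)) = scons a fun n => (θ n).realize ρ := by
    intro θ ρ a
    funext n
    cases n with
    | zero => rfl
    | succ n => exact Term.realize_relabel
  induction φ with
  | eq s t | neq s t | lt s t | nlt s t => intro θ ρ; simp only [subst, Sat, Term.realize_subst]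
  | and φ ψ ih₁ ih₂ | or φ ψ ih₁ ih₂ => intro θ ρ; simp only [subst, Sat, ih₁, ih₂]
  | all φ ih | ex φ ih => intro θ ρ; simp only [subst_all, subst_ex, Sat, ih, key]

theorem sat_inst (φ : Form) (t : Tm) (ρ : ℕ → M) :
    (φ.inst t).Sat ρ ↔ φ.Sat (scons (t.realize ρ) ρ) := by
  rw [inst, sat_subst]
  have : (fun n => (scons t v n).realize ρ) = scons (t.realize ρ) ρ := by
    funext n; cases n <;> rfl
  rw [this]

theorem sat_neg (φ : Form) : ∀ ρ : ℕ → M, φ.neg.Sat ρ ↔ ¬ φ.Sat ρ := by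
  induction φ with
  | eq s t | neq s t | lt s t | nlt s t => intro ρ; simp [neg, Sat]
  | and φ ψ ih₁ ih₂ | or φ ψ ih₁ ih₂ => intro ρ; simp only [neg, Sat, ih₁, ih₂]; tauto
  | all φ ih | ex φ ih => intro ρ; simp only [neg, Sat, ih]; push Not; rfl

theorem sat_imp (φ ψ : Form) (ρ : ℕ → M) : (imp φ ψ).Sat ρ ↔ (φ.Sat ρ → ψ.Sat ρ) := by
  simp only [imp, Sat, sat_neg]; tauto

end Semantics

end Form

/-- The sequence `u 0, …, u (k - 1), ρ 0, ρ 1, …`. -/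
def blk {α : Type*} (k : ℕ) (u ρ : ℕ → α) : ℕ → α := fun i => if i < k then u i else ρ (i - k)

theorem blk_lt {α : Type*} {k i : ℕ} {u ρ : ℕ → α} (h : i < k) : blk k u ρ i = u i := if_pos h

theorem blk_add {α : Type*} (k i : ℕ) (u ρ : ℕ → α) : blk k u ρ (k + i) = ρ i := by
  simp [blk]

/-- In `all^[k + 1]` and `ex^[k + 1]` the outermost quantifier binds the variable `k` of the matrix,
so the last entry of a block is the one to peel off. -/
theorem blk_succ {α : Type*} (k : ℕ) (u ρ : ℕ → α) :
    blk (k + 1) u ρ = blk k u (scons (u k) ρ) := by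
  funext i
  rcases lt_trichotomy i k with h | rfl | h
  · simp [blk, h, h.trans k.lt_succ_self]
  · simp [blk, scons]
  · obtain ⟨j, rfl⟩ := Nat.exists_eq_add_of_lt h
    simp only [blk, show ¬ k + j + 1 < k + 1 by omega, show ¬ k + j + 1 < k by omega, if_false,
      show k + j + 1 - k = j + 1 by omega, show k + j + 1 - (k + 1) = j by omega]
    rfl

-- Iterated quantifiers and universal closures.

namespace Form

section Semantics

variable {M : Type} [arith.Structure M]

theorem sat_all_iterate (k : ℕ) (φ : Form) : ∀ ρ : ℕ → M,
    (all^[k] φ).Sat ρ ↔ ∀ u : ℕ → M, φ.Sat (blk k u ρ) := by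
  induction k generalizing φ with
  | zero => intro ρ; exact ⟨fun h _ => h, fun h => h ρ⟩
  | succ k ih =>
    intro ρ
    rw [Function.iterate_succ_apply']
    simp only [Sat, ih]
    constructor
    · intro h u
      rw [blk_succ]
      exact h _ _
    · intro h a u
      have := h fun i => if i = k then a else u i
      rw [blk_succ] at this
      convert this using 1
      funext i
      simp only [blk, if_true]
      split_ifs with h1 h2
      · omega
      · rfl
      · rfl

theorem neg_all_iterate (k : ℕ) (φ : Form) : (all^[k] φ).neg = ex^[k] φ.neg := by
  induction k with
  | zero => rfl
  | succ k ih => rw [Function.iterate_succ_apply', Function.iterate_succ_apply', neg, ih]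

theorem neg_ex_iterate (k : ℕ) (φ : Form) : (ex^[k] φ).neg = all^[k] φ.neg := by
  induction k with
  | zero => rfl
  | succ k ih => rw [Function.iterate_succ_apply', Function.iterate_succ_apply', neg, ih]

theorem sat_ex_iterate (k : ℕ) (φ : Form) (ρ : ℕ → M) :
    (ex^[k] φ).Sat ρ ↔ ∃ u : ℕ → M, φ.Sat (blk k u ρ) := by
  rw [← not_iff_not, ← sat_neg, neg_ex_iterate, sat_all_iterate]
  push Not
  simp only [sat_neg]

/-- Any assignment is a block of its own first values followed by its own shift. Hence the number of
quantifiers in front does not matter. -/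
theorem sat_closure {φ : Form} : (∀ ρ : ℕ → M, φ.closure.Sat ρ) ↔ ∀ ρ : ℕ → M, φ.Sat ρ := by
  simp only [closure, sat_all_iterate]
  refine ⟨fun h ρ => ?_, fun h _ _ => h _⟩
  convert h (fun i => ρ (i + φ.freeVars.sup Nat.succ)) ρ using 1
  funext i
  simp only [blk]
  split_ifs with hi
  · rfl
  · congr 1; omega

end Semantics

theorem subst_all_iterate (k : ℕ) (φ : Form) (θ : Subst) :
    (all^[k] φ).subst θ = all^[k] (φ.subst (up^[k] θ)) := by
  induction k generalizing θ with
  | zero => rfl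
  | succ k ih => rw [Function.iterate_succ_apply', subst_all, ih, Function.iterate_succ_apply',
      Function.iterate_succ_apply]

theorem subst_ex_iterate (k : ℕ) (φ : Form) (θ : Subst) :
    (ex^[k] φ).subst θ = ex^[k] (φ.subst (up^[k] θ)) := by
  induction k generalizing θ with
  | zero => rfl
  | succ k ih => rw [Function.iterate_succ_apply', subst_ex, ih, Function.iterate_succ_apply',
      Function.iterate_succ_apply]

theorem Bounded.subst {φ : Form} (h : Bounded φ) : ∀ θ, Bounded (φ.subst θ) := by
  induction h with
  | eq | neq | lt | nlt => intro θ; constructor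
  | and _ _ ih₁ ih₂ => intro θ; exact .and (ih₁ θ) (ih₂ θ)
  | or _ _ ih₁ ih₂ => intro θ; exact .or (ih₁ θ) (ih₂ θ)
  | ball t _ ih =>
    intro θ
    have := (ih (up θ)).ball (t.subst θ)
    rwa [ballLT, ← lift_subst_up] at this
  | bex t _ ih =>
    intro θ
    have := (ih (up θ)).bex (t.subst θ)
    rwa [bexLT, ← lift_subst_up] at this

theorem Bounded.neg {φ : Form} (h : Bounded φ) : Bounded φ.neg := by
  induction h with
  | eq | neq | lt | nlt => constructor
  | and _ _ ih₁ ih₂ => exact .or ih₁ ih₂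
  | or _ _ ih₁ ih₂ => exact .and ih₁ ih₂
  | ball t _ ih => exact ih.bex t
  | bex t _ ih => exact ih.ball t

end Form

/-! ## The arithmetical hierarchy -/

theorem mem_sigmaClass_succ {n : ℕ} {ψ : Form} :
    ψ ∈ SigmaClass (n + 1) ↔ ∃ (k : ℕ) (φ : Form), φ ∈ PiClass n ∧ ψ = ex^[k] φ := by
  rw [SigmaClass]; rfl

theorem mem_piClass_succ {n : ℕ} {ψ : Form} :
    ψ ∈ PiClass (n + 1) ↔ ∃ (k : ℕ) (φ : Form), φ ∈ SigmaClass n ∧ ψ = all^[k] φ := by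
  rw [PiClass]; rfl

theorem mem_sigmaClass_zero {ψ : Form} : ψ ∈ SigmaClass 0 ↔ Bounded ψ := by
  rw [SigmaClass]; rfl

theorem mem_piClass_zero {ψ : Form} : ψ ∈ PiClass 0 ↔ Bounded ψ := by
  rw [PiClass]; rfl

/-- A class of formulae that contains the bounded ones and is closed under substitution and
subformulae. -/
structure ClosedClass (Φ : Set Form) : Prop where
  bounded : ∀ {φ}, Bounded φ → φ ∈ Φ
  subst : ∀ {φ}, φ ∈ Φ → ∀ θ, φ.subst θ ∈ Φ
  and_left : ∀ {φ ψ : Form}, φ.and ψ ∈ Φ → φ ∈ Φ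
  and_right : ∀ {φ ψ : Form}, φ.and ψ ∈ Φ → ψ ∈ Φ
  or_left : ∀ {φ ψ : Form}, φ.or ψ ∈ Φ → φ ∈ Φ
  or_right : ∀ {φ ψ : Form}, φ.or ψ ∈ Φ → ψ ∈ Φ
  all_body : ∀ {φ}, all φ ∈ Φ → φ ∈ Φ
  ex_body : ∀ {φ}, ex φ ∈ Φ → φ ∈ Φ

theorem closedClass_bounded : ClosedClass {φ | Bounded φ} where
  bounded h := h
  subst h := h.subst
  and_left h := by cases h; assumption
  and_right h := by cases h; assumption
  or_left h := by cases h; assumption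
  or_right h := by cases h; assumption
  -- A quantifier of a bounded formula comes with its guard, which is an atom or a negated atom and
  -- hence bounded by itself.
  all_body {φ} h := by
    generalize e : Form.all φ = χ at h
    cases h with
    | ball t h => cases e; exact .or (.nlt _ _) h
    | _ => cases e
  ex_body {φ} h := by
    generalize e : Form.ex φ = χ at h
    cases h with
    | bex t h => cases e; exact .and (.lt _ _) h
    | _ => cases e

/-- Blocks may be empty, so a formula of Σₙ₊₁ that does not begin with ∃ lies in Πₙ, and dually.
Closure under subformulae thus descends a level, except that removing a quantifier from a nonempty
block shortens it. -/
theorem closedClass_sigma_pi (n : ℕ) : ClosedClass (SigmaClass n) ∧ ClosedClass (PiClass n) := by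
  induction n with
  | zero =>
    rw [SigmaClass, PiClass]
    exact ⟨closedClass_bounded, closedClass_bounded⟩
  | succ n ih =>
    have hS : ∀ {φ}, φ ∈ PiClass n → φ ∈ SigmaClass (n + 1) :=
      fun {φ} h => mem_sigmaClass_succ.2 ⟨0, φ, h, rfl⟩
    have hP : ∀ {φ}, φ ∈ SigmaClass n → φ ∈ PiClass (n + 1) :=
      fun {φ} h => mem_piClass_succ.2 ⟨0, φ, h, rfl⟩
    have hS' : ∀ {φ}, φ ∈ SigmaClass (n + 1) → (∀ ψ, φ ≠ ex ψ) → φ ∈ PiClass n := by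
      intro φ h hne
      obtain ⟨k, χ, hχ, rfl⟩ := mem_sigmaClass_succ.1 h
      cases k with
      | zero => exact hχ
      | succ k => exact absurd (Function.iterate_succ_apply' ex k χ) (hne _)
    have hP' : ∀ {φ}, φ ∈ PiClass (n + 1) → (∀ ψ, φ ≠ all ψ) → φ ∈ SigmaClass n := by
      intro φ h hne
      obtain ⟨k, χ, hχ, rfl⟩ := mem_piClass_succ.1 h
      cases k with
      | zero => exact hχ
      | succ k => exact absurd (Function.iterate_succ_apply' all k χ) (hne _)
    constructor
    · exact
      { bounded := fun h => hS (ih.2.bounded h)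
        subst := by
          intro φ h θ
          obtain ⟨k, χ, hχ, rfl⟩ := mem_sigmaClass_succ.1 h
          exact mem_sigmaClass_succ.2 ⟨k, _, ih.2.subst hχ _, subst_ex_iterate _ _ _⟩
        and_left := fun h => hS (ih.2.and_left (hS' h (by simp)))
        and_right := fun h => hS (ih.2.and_right (hS' h (by simp)))
        or_left := fun h => hS (ih.2.or_left (hS' h (by simp)))
        or_right := fun h => hS (ih.2.or_right (hS' h (by simp)))
        all_body := fun h => hS (ih.2.all_body (hS' h (by simp)))
        ex_body := by
          intro φ h
          obtain ⟨k, χ, hχ, e⟩ := mem_sigmaClass_succ.1 h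
          cases k with
          | zero => exact hS (ih.2.ex_body (by rw [e]; exact hχ))
          | succ k =>
            rw [Function.iterate_succ_apply'] at e
            cases e
            exact mem_sigmaClass_succ.2 ⟨k, _, hχ, rfl⟩ }
    · exact
      { bounded := fun h => hP (ih.1.bounded h)
        subst := by
          intro φ h θ
          obtain ⟨k, χ, hχ, rfl⟩ := mem_piClass_succ.1 h
          exact mem_piClass_succ.2 ⟨k, _, ih.1.subst hχ _, subst_all_iterate _ _ _⟩
        and_left := fun h => hP (ih.1.and_left (hP' h (by simp)))
        and_right := fun h => hP (ih.1.and_right (hP' h (by simp)))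
        or_left := fun h => hP (ih.1.or_left (hP' h (by simp)))
        or_right := fun h => hP (ih.1.or_right (hP' h (by simp)))
        ex_body := fun h => hP (ih.1.ex_body (hP' h (by simp)))
        all_body := by
          intro φ h
          obtain ⟨k, χ, hχ, e⟩ := mem_piClass_succ.1 h
          cases k with
          | zero => exact hP (ih.1.all_body (by rw [e]; exact hχ))
          | succ k =>
            rw [Function.iterate_succ_apply'] at e
            cases e
            exact mem_piClass_succ.2 ⟨k, _, hχ, rfl⟩ }

theorem neg_mem_sigma_pi (n : ℕ) : (∀ φ ∈ SigmaClass n, φ.neg ∈ PiClass n) ∧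
    ∀ φ ∈ PiClass n, φ.neg ∈ SigmaClass n := by
  induction n with
  | zero =>
    simp only [mem_sigmaClass_zero, mem_piClass_zero]
    exact ⟨fun _ h => h.neg, fun _ h => h.neg⟩
  | succ n ih =>
    constructor
    · intro φ h
      obtain ⟨k, χ, hχ, rfl⟩ := mem_sigmaClass_succ.1 h
      exact mem_piClass_succ.2 ⟨k, _, ih.2 _ hχ, neg_ex_iterate _ _⟩
    · intro φ h
      obtain ⟨k, χ, hχ, rfl⟩ := mem_piClass_succ.1 h
      exact mem_sigmaClass_succ.2 ⟨k, _, ih.1 _ hχ, neg_all_iterate _ _⟩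

/-- The disjunction of a bounded and a `Σₙ` (`Πₙ`) formula is equivalent to a `Σₙ` (`Πₙ`)
formula. -/
theorem exists_equiv_or (n : ℕ) :
    (∀ α σ : Form, Bounded α → σ ∈ SigmaClass n → ∃ χ ∈ SigmaClass n,
      ∀ (M : Type) [arith.Structure M] (ρ : ℕ → M), χ.Sat ρ ↔ α.Sat ρ ∨ σ.Sat ρ) ∧
    ∀ α σ : Form, Bounded α → σ ∈ PiClass n → ∃ χ ∈ PiClass n,
      ∀ (M : Type) [arith.Structure M] (ρ : ℕ → M), χ.Sat ρ ↔ α.Sat ρ ∨ σ.Sat ρ := by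
  -- To enter the scope of `k` quantifiers, the bounded disjunct has its variables renamed past the
  -- block.
  have shift : ∀ (α : Form) (k : ℕ) (M : Type) [arith.Structure M] (ρ u : ℕ → M),
      (α.subst fun i => v (k + i)).Sat (blk k u ρ) ↔ α.Sat ρ := by
    intro α k M _ ρ u
    rw [sat_subst]
    have : (fun n => (v (k + n)).realize (blk k u ρ)) = ρ := by
      funext i; exact blk_add k i u ρ
    rw [this]
  induction n with
  | zero =>
    simp only [mem_sigmaClass_zero, mem_piClass_zero]
    exact ⟨fun α σ hα hσ => ⟨.or α σ, hα.or hσ, fun _ _ _ => Iff.rfl⟩,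
      fun α σ hα hσ => ⟨.or α σ, hα.or hσ, fun _ _ _ => Iff.rfl⟩⟩
  | succ n ih =>
    constructor
    · intro α σ hα hσ
      obtain ⟨k, π, hπ, rfl⟩ := mem_sigmaClass_succ.1 hσ
      obtain ⟨χ, hχ, h⟩ := ih.2 (α.subst fun i => v (k + i)) π (hα.subst _) hπ
      refine ⟨_, mem_sigmaClass_succ.2 ⟨k, χ, hχ, rfl⟩, fun M _ ρ => ?_⟩
      simp only [sat_ex_iterate, h, shift]
      have : Nonempty (ℕ → M) := ⟨ρ⟩
      rw [exists_or, exists_const]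
    · intro α σ hα hσ
      obtain ⟨k, π, hπ, rfl⟩ := mem_piClass_succ.1 hσ
      obtain ⟨χ, hχ, h⟩ := ih.1 (α.subst fun i => v (k + i)) π (hα.subst _) hπ
      refine ⟨_, mem_piClass_succ.2 ⟨k, χ, hχ, rfl⟩, fun M _ ρ => ?_⟩
      simp only [sat_all_iterate, h, shift]
      exact forall_or_left

/-! ## Finite graphs of inference steps with open leaves -/

/-- `t'` is a precursor of `t` at a step by the rule `r` with conclusion `S`. -/
def Precedes (r : Option Subst) (S : Sequent) (t' t : Tm) : Prop :=
  match r with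
  | some θ => t = t'.subst θ
  | none => eq t' t ∈ S.ant ∨ t' = t

/-- The trace `t` along the sequents `S` and rules `R` progresses at `i + 1`. -/
def Progresses (S : ℕ → Sequent) (R : ℕ → Option Subst) (t : ℕ → Tm) (i : ℕ) : Prop :=
  ∃ u, Precedes (R i) (S i) u (t i) ∧ lt (t (i + 1)) u ∈ (S (i + 1)).ant

/-- Some trace along the sequents `S` and rules `R` progresses infinitely often. -/
def HasProgressingTrace (S : ℕ → Sequent) (R : ℕ → Option Subst) : Prop :=
  ∃ (n : ℕ) (t : ℕ → Tm), (∀ i ≥ n, (S i).Occurs (t i) ∧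
    (Precedes (R i) (S i) (t (i + 1)) (t i) ∨ Progresses S R t i)) ∧
    ∀ m, ∃ i ≥ m, Progresses S R t i

theorem HasProgressingTrace.of_tail {S : ℕ → Sequent} {R : ℕ → Option Subst} (m : ℕ)
    (h : HasProgressingTrace (fun i => S (m + i)) fun i => R (m + i)) :
    HasProgressingTrace S R := by
  obtain ⟨n, t, h₁, h₂⟩ := h
  -- The truncated `i - m` gives junk values before time `m`; they precede the start `m + n` of the
  -- trace.
  have e : ∀ j, (fun i => t (i - m)) (m + j) = t j := fun j => by simp
  have e' : ∀ j, (fun i => t (i - m)) (m + j + 1) = t (j + 1) := fun j => e (j + 1)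
  refine ⟨m + n, fun i => t (i - m), ?_, ?_⟩
  · intro i hi
    obtain ⟨j, rfl⟩ := Nat.exists_eq_add_of_le (le_trans (Nat.le_add_right m n) hi)
    have := h₁ j (by omega)
    simp only [Progresses, e, e'] at this ⊢
    exact this
  · intro k
    obtain ⟨j, hj, u, hu⟩ := h₂ k
    refine ⟨m + j, by omega, u, ?_⟩
    simp only [e, e']
    exact hu

/-- All formulae of the sequent are in `Φ`, and the variables in `P` occur in it, in the shape
`x = x` on the left. -/
def Sequent.Admissible (Φ : Set Form) (P : Finset ℕ) (S : Sequent) : Prop :=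
  (∀ p ∈ P, eq (v p) (v p) ∈ S.ant) ∧ ∀ φ ∈ S.ant ∪ S.suc, φ ∈ Φ

theorem Sequent.Admissible.occurs {Φ : Set Form} {P : Finset ℕ} {S : Sequent}
    (h : S.Admissible Φ P) {p : ℕ} (hp : p ∈ P) : S.Occurs (v p) :=
  ⟨eq (v p) (v p), Finset.mem_union_left _ (h.1 p hp), Or.inl rfl⟩

theorem Sequent.Admissible.mono {Φ : Set Form} {P P' : Finset ℕ} {S : Sequent}
    (h : S.Admissible Φ P) (hP : P' ⊆ P) : S.Admissible Φ P' :=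
  ⟨fun p hp => h.1 p (hP hp), h.2⟩

noncomputable def Sequent.subst (θ : Subst) (S : Sequent) : Sequent :=
  ⟨S.ant.image (Form.subst θ), S.suc.image (Form.subst θ)⟩

theorem Infers.weaken {Γ Γ' Δ Δ' : Finset Form} (hΓ : Γ ⊆ Γ') (hΔ : Δ ⊆ Δ') :
    Infers none [⟨Γ, Δ⟩] ⟨Γ', Δ'⟩ := by
  have := Infers.wk Γ Γ' Δ Δ'
  rwa [Finset.union_eq_right.2 hΓ, Finset.union_eq_right.2 hΔ] at this

theorem Infers.repeat (S : Sequent) : Infers none [S] S :=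
  Infers.weaken (Finset.Subset.refl _) (Finset.Subset.refl _)

/-- A finite graph of inference steps with formulae in `Φ` and open leaves in `H`. Its steps preserve
the variables in `P`, and its infinite paths have infinitely progressing traces. -/
structure OpenGraph (Φ : Set Form) (P : Finset ℕ) (H : Set Sequent) : Type 1 where
  Node : Type
  finite : Finite Node
  seq : Node → Sequent
  rule : Node → Option Subst
  prem : Node → List Node
  leaf : Set Node
  correct : ∀ x ∉ leaf, Infers (rule x) ((prem x).map seq) (seq x)
  leaf_prem : ∀ x ∈ leaf, prem x = []
  leaf_seq : ∀ x ∈ leaf, seq x ∈ H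
  admissible : ∀ x, (seq x).Admissible Φ P
  fixes : ∀ x θ, rule x = some θ → ∀ p ∈ P, θ p = v p
  good : ∀ b : ℕ → Node, (∀ i, b (i + 1) ∈ prem (b i)) →
    HasProgressingTrace (fun i => seq (b i)) fun i => rule (b i)

/-- `S` is the conclusion of a node of a finite graph with open leaves in `H`. -/
def Derives (Φ : Set Form) (P : Finset ℕ) (H : Set Sequent) (S : Sequent) : Prop :=
  ∃ (G : OpenGraph Φ P H) (x : G.Node), G.seq x = S

namespace OpenGraph

variable {Φ : Set Form} {P : Finset ℕ} {H : Set Sequent}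

theorem precedes_self (G : OpenGraph Φ P H) (x : G.Node) {p : ℕ} (hp : p ∈ P) :
    Precedes (G.rule x) (G.seq x) (v p) (v p) := by
  cases h : G.rule x with
  | none => exact Or.inr rfl
  | some θ => exact (G.fixes x θ h p hp).symm

/-- A path that remains in a copy of an open graph has an infinitely progressing trace. -/
theorem good_of_eventually (G : OpenGraph Φ P H) {N : Type} {seq : N → Sequent}
    {rule : N → Option Subst} {prem : N → List N} (ι : G.Node → N)
    (hseq : ∀ x, seq (ι x) = G.seq x)
    (h : ∀ x y, ι y ∈ prem (ι x) → y ∈ G.prem x ∧ rule (ι x) = G.rule x) {b : ℕ → N}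
    (hb : ∀ i, b (i + 1) ∈ prem (b i)) {m : ℕ} (hm : ∀ i ≥ m, b i ∈ Set.range ι) :
    HasProgressingTrace (fun i => seq (b i)) fun i => rule (b i) := by
  choose b' hb' using fun i => hm (m + i) (Nat.le_add_right m i)
  have step : ∀ i, b' (i + 1) ∈ G.prem (b' i) ∧ rule (ι (b' i)) = G.rule (b' i) := by
    intro i
    refine h _ _ ?_
    rw [hb', hb']
    exact hb (m + i)
  refine .of_tail m ?_
  have := G.good b' fun i => (step i).1
  simp only [← hseq, ← fun i => (step i).2, hb'] at this
  exact this

end OpenGraph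

-- Composing graphs and closing cycles.

namespace Derives

variable {Φ : Set Form} {P : Finset ℕ} {H H' : Set Sequent} {S : Sequent}

theorem admissible (h : Derives Φ P H S) : S.Admissible Φ P := by
  obtain ⟨G, x, rfl⟩ := h
  exact G.admissible x

theorem hyp (hS : S ∈ H) (ha : S.Admissible Φ P) : Derives Φ P H S :=
  ⟨{  Node := Unit
      finite := inferInstance
      seq := fun _ => S
      rule := fun _ => none
      prem := fun _ => []
      leaf := Set.univ
      correct := fun x hx => absurd (Set.mem_univ x) hx
      leaf_prem := fun _ _ => rfl
      leaf_seq := fun _ _ => hS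
      admissible := fun _ => ha
      fixes := fun _ _ h => by cases h
      good := fun b hb => by simpa using hb 0 }, (), rfl⟩

/-- One new root is put below disjoint copies of the graphs of the premisses. After one step an
infinite path is in some copy, which it never leaves, so its trace is found there. -/
theorem step {r : Option Subst} {Ps : List Sequent} (h : Infers r Ps S)
    (hr : ∀ θ, r = some θ → ∀ p ∈ P, θ p = v p) (ha : S.Admissible Φ P)
    (hP : ∀ T ∈ Ps, Derives Φ P H T) : Derives Φ P H S := by
  choose G x hx using fun i : Fin Ps.length => hP (Ps.get i) (List.get_mem _ _)
  have hfin := fun i => (G i).finite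
  let seq : Option (Σ i, (G i).Node) → Sequent := fun y => y.elim S fun y => (G y.1).seq y.2
  let rule : Option (Σ i, (G i).Node) → Option Subst := fun y => y.elim r fun y => (G y.1).rule y.2
  let prem : Option (Σ i, (G i).Node) → List (Option (Σ i, (G i).Node)) := fun y =>
    y.elim (List.ofFn fun i => some ⟨i, x i⟩) fun y => ((G y.1).prem y.2).map fun z => some ⟨y.1, z⟩
  refine ⟨{
      Node := Option (Σ i, (G i).Node)
      finite := inferInstance
      seq := seq
      rule := rule
      prem := prem
      leaf := {y | y.elim False fun y => y.2 ∈ (G y.1).leaf}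
      correct := ?_
      leaf_prem := ?_
      leaf_seq := ?_
      admissible := ?_
      fixes := ?_
      good := ?_ }, none, rfl⟩
  · rintro (_ | ⟨i, y⟩) hy
    · simp only [prem, seq, rule, Option.elim, List.map_ofFn, Function.comp_def, hx]
      simpa using h
    · simpa [prem, seq, rule, Function.comp_def] using (G i).correct y hy
  · rintro (_ | ⟨i, y⟩) hy
    · exact hy.elim
    · simpa [prem] using (G i).leaf_prem y hy
  · rintro (_ | ⟨i, y⟩) hy
    · exact hy.elim
    · exact (G i).leaf_seq y hy
  · rintro (_ | ⟨i, y⟩)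
    · exact ha
    · exact (G i).admissible y
  · rintro (_ | ⟨i, y⟩) θ hθ
    · exact hr θ hθ
    · exact (G i).fixes y θ hθ
  · intro b hb
    obtain ⟨i, y, hy⟩ : ∃ i y, b 1 = some ⟨i, y⟩ := by
      have h0 := hb 0
      rcases e : b 0 with _ | ⟨i, y⟩ <;> rw [e] at h0
      · obtain ⟨i, hi⟩ := List.mem_ofFn.1 h0
        exact ⟨i, x i, hi.symm⟩
      · obtain ⟨z, -, hz⟩ := List.mem_map.1 h0
        exact ⟨i, z, hz.symm⟩
    refine (G i).good_of_eventually (seq := seq) (rule := rule) (prem := prem) (m := 1) (fun y => some ⟨i, y⟩) (fun y => rfl) ?_ hb ?_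
    · intro y z hz
      obtain ⟨w, hw, e⟩ := List.mem_map.1 hz
      cases e
      exact ⟨hw, rfl⟩
    · intro j hj
      induction j, hj using Nat.le_induction with
      | base => exact ⟨y, hy.symm⟩
      | succ j _ ih =>
        obtain ⟨z, hz⟩ := ih
        have := hb j
        rw [← hz] at this
        obtain ⟨w, -, e⟩ := List.mem_map.1 this
        exact ⟨w, e⟩

/-- Open leaves may be replaced by derivations of them. -/
theorem graft (h : Derives Φ P H' S) (hH : ∀ T ∈ H', T.Admissible Φ P → Derives Φ P H T) :
    Derives Φ P H S := by
  classical
  obtain ⟨G₀, x₀, rfl⟩ := h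
  choose G x hx using fun y : G₀.leaf => hH _ (G₀.leaf_seq y y.2) (G₀.admissible y)
  have hfin₀ := G₀.finite
  have hfin := fun y => (G y).finite
  let N : Type := G₀.Node ⊕ Σ y, (G y).Node
  let seq : N → Sequent := Sum.elim G₀.seq fun y => (G y.1).seq y.2
  let rule : N → Option Subst :=
    Sum.elim (fun y => if y ∈ G₀.leaf then none else G₀.rule y) fun y => (G y.1).rule y.2
  let prem : N → List N := Sum.elim
    (fun y => if hy : y ∈ G₀.leaf then [.inr ⟨⟨y, hy⟩, x ⟨y, hy⟩⟩] else (G₀.prem y).map .inl)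
    fun y => ((G y.1).prem y.2).map fun z => .inr ⟨y.1, z⟩
  have prem₀ : ∀ x, x ∉ G₀.leaf → prem (.inl x) = (G₀.prem x).map .inl := fun x hx => dif_neg hx
  have prem₀' : ∀ y (hy : y ∈ G₀.leaf), prem (.inl y) = [.inr ⟨⟨y, hy⟩, x ⟨y, hy⟩⟩] :=
    fun x hx => dif_pos hx
  have rule₀ : ∀ x, x ∉ G₀.leaf → rule (.inl x) = G₀.rule x := fun x hx => if_neg hx
  have rule₀' : ∀ x, x ∈ G₀.leaf → rule (.inl x) = none := fun x hx => if_pos hx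
  refine ⟨{
      Node := N
      finite := inferInstanceAs (Finite (G₀.Node ⊕ Σ y, (G y).Node))
      seq := seq
      rule := rule
      prem := prem
      leaf := {y | y.elim (fun _ => False) fun y => y.2 ∈ (G y.1).leaf}
      correct := ?_
      leaf_prem := ?_
      leaf_seq := ?_
      admissible := ?_
      fixes := ?_
      good := ?_ }, .inl x₀, rfl⟩
  · rintro (y | ⟨i, y⟩) hy
    · by_cases hl : y ∈ G₀.leaf
      -- A grafted leaf and the root of its derivation bear the same sequent; a vacuous weakening
      -- links them.
      · rw [rule₀' y hl, prem₀' y hl]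
        change Infers none [(G ⟨y, hl⟩).seq (x ⟨y, hl⟩)] (G₀.seq y)
        rw [hx]
        exact Infers.repeat _
      · rw [rule₀ y hl, prem₀ y hl, List.map_map]
        exact G₀.correct y hl
    · simpa [prem, seq, rule, Function.comp_def] using (G i).correct y hy
  · rintro (y | ⟨i, y⟩) hy
    · exact hy.elim
    · simpa [prem] using (G i).leaf_prem y hy
  · rintro (y | ⟨i, y⟩) hy
    · exact hy.elim
    · exact (G i).leaf_seq y hy
  · rintro (y | ⟨i, y⟩)
    · exact G₀.admissible y
    · exact (G i).admissible y
  · rintro (y | ⟨i, y⟩) θ hθ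
    · by_cases hl : y ∈ G₀.leaf
      · rw [rule₀' y hl] at hθ; cases hθ
      · rw [rule₀ y hl] at hθ
        exact G₀.fixes y θ hθ
    · exact (G i).fixes y θ hθ
  · intro b hb
    -- Either the path stays in `G₀`, or it enters a grafted copy, from which no edge leads out.
    by_cases hb' : ∀ j, b j ∈ Set.range Sum.inl
    · refine G₀.good_of_eventually (seq := seq) (rule := rule) (prem := prem) (m := 0) Sum.inl (fun y => rfl) ?_ hb fun j _ => hb' j
      intro y z hz
      by_cases hl : y ∈ G₀.leaf
      · simp [prem₀' y hl] at hz
      · rw [prem₀ y hl] at hz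
        obtain ⟨w, hw, e⟩ := List.mem_map.1 hz
        cases e
        exact ⟨hw, rule₀ y hl⟩
    · push Not at hb'
      obtain ⟨m, hm⟩ := hb'
      obtain ⟨i, y, hy⟩ : ∃ i y, b m = .inr ⟨i, y⟩ := by
        rcases e : b m with y | ⟨i, y⟩
        · exact absurd ⟨y, e.symm⟩ hm
        · exact ⟨i, y, rfl⟩
      refine (G i).good_of_eventually (seq := seq) (rule := rule) (prem := prem) (m := m) (fun y => .inr ⟨i, y⟩) (fun y => rfl) ?_ hb ?_
      · intro y z hz
        obtain ⟨w, hw, e⟩ := List.mem_map.1 hz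
        cases e
        exact ⟨hw, rfl⟩
      · intro j hj
        induction j, hj using Nat.le_induction with
        | base => exact ⟨y, hy.symm⟩
        | succ j _ ih =>
          obtain ⟨z, hz⟩ := ih
          have := hb j
          rw [← hz] at this
          obtain ⟨w, -, e⟩ := List.mem_map.1 this
          exact ⟨w, e⟩

theorem mono (h : Derives Φ P H' S) (hH : H' ⊆ H) :
    Derives Φ P H S := by
  obtain ⟨G, x, rfl⟩ := h
  exact ⟨{ G with leaf_seq := fun y hy => hH (G.leaf_seq y hy) }, x, rfl⟩

/-- Two derivations form a cycle: the first one, of `S₀`, preserves the variable `c`, and leads to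
`S₁`, which has `c' < c` on the left; the second one, of `S₁`, preserves the variable `c'`, and
leads back to instances of `S₀` where `c` becomes `c'`. -/
theorem loop {c c' : ℕ} {S₀ S₁ : Sequent} (h₀ : Derives Φ (insert c P) (H ∪ {S₁}) S₀)
    (h₁ : Derives Φ (insert c' P)
      (H ∪ {S | ∃ θ : Subst, θ c = v c' ∧ (∀ p ∈ P, θ p = v p) ∧ S = S₀.subst θ}) S₁)
    (hlt : lt (v c') (v c) ∈ S₁.ant) : Derives Φ P H S₀ := by
  classical
  obtain ⟨G₀, x₀, rfl⟩ := h₀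
  obtain ⟨G₁, x₁, hx₁⟩ := h₁
  have hfin₀ := G₀.finite
  have hfin₁ := G₁.finite
  -- `B₀` are the leaves that continue at `S₁`, and `B₁` those that return to `S₀` by a substitution
  -- step. All other leaves are in `H` and stay open.
  let B₀ : Set G₀.Node := {x | x ∈ G₀.leaf ∧ G₀.seq x = S₁}
  let B₁ : Set G₁.Node := {x | x ∈ G₁.leaf ∧
    ∃ θ : Subst, θ c = v c' ∧ (∀ p ∈ P, θ p = v p) ∧ G₁.seq x = (G₀.seq x₀).subst θ}
  choose θ hθ using fun x : B₁ => x.2.2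
  let seq : G₀.Node ⊕ G₁.Node → Sequent := Sum.elim G₀.seq G₁.seq
  let rule : G₀.Node ⊕ G₁.Node → Option Subst :=
    Sum.elim (fun x => if x ∈ B₀ then none else G₀.rule x)
      fun x => if hx : x ∈ B₁ then some (θ ⟨x, hx⟩) else G₁.rule x
  let prem : G₀.Node ⊕ G₁.Node → List (G₀.Node ⊕ G₁.Node) :=
    Sum.elim (fun x => if x ∈ B₀ then [.inr x₁] else (G₀.prem x).map .inl)
      fun x => if x ∈ B₁ then [.inl x₀] else (G₁.prem x).map .inr
  have prem₀ : ∀ x, x ∉ B₀ → prem (.inl x) = (G₀.prem x).map .inl := fun x hx => if_neg hx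
  have prem₀' : ∀ x, x ∈ B₀ → prem (.inl x) = [.inr x₁] := fun x hx => if_pos hx
  have rule₀ : ∀ x, x ∉ B₀ → rule (.inl x) = G₀.rule x := fun x hx => if_neg hx
  have rule₀' : ∀ x, x ∈ B₀ → rule (.inl x) = none := fun x hx => if_pos hx
  have prem₁ : ∀ x, x ∉ B₁ → prem (.inr x) = (G₁.prem x).map .inr := fun x hx => if_neg hx
  have prem₁' : ∀ x, x ∈ B₁ → prem (.inr x) = [.inl x₀] := fun x hx => if_pos hx
  have rule₁ : ∀ x, x ∉ B₁ → rule (.inr x) = G₁.rule x := fun x hx => dif_neg hx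
  have rule₁' : ∀ x (hx : x ∈ B₁), rule (.inr x) = some (θ ⟨x, hx⟩) := fun x hx => dif_pos hx
  have good : ∀ b : ℕ → G₀.Node ⊕ G₁.Node, (∀ i, b (i + 1) ∈ prem (b i)) →
      HasProgressingTrace (fun i => seq (b i)) fun i => rule (b i) := by
    intro b hb
    -- A path that eventually stays in one of the two graphs has a trace there.
    by_cases e₀ : ∃ m, ∀ i ≥ m, b i ∈ Set.range Sum.inl
    · obtain ⟨m, hm⟩ := e₀
      refine G₀.good_of_eventually (seq := seq) (rule := rule) (prem := prem) Sum.inl (fun y => rfl) ?_ hb hm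
      intro y z hz
      by_cases hy : y ∈ B₀
      · simp [prem₀' y hy] at hz
      · exact ⟨by simpa [prem₀ y hy] using hz, rule₀ y hy⟩
    by_cases e₁ : ∃ m, ∀ i ≥ m, b i ∈ Set.range Sum.inr
    · obtain ⟨m, hm⟩ := e₁
      refine G₁.good_of_eventually (seq := seq) (rule := rule) (prem := prem) Sum.inr (fun y => rfl) ?_ hb hm
      intro y z hz
      by_cases hy : y ∈ B₁
      · simp [prem₁' y hy] at hz
      · exact ⟨by simpa [prem₁ y hy] using hz, rule₁ y hy⟩
    push Not at e₀ e₁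
    have cross : ∀ x y, Sum.inr y ∈ prem (.inl x) → x ∈ B₀ ∧ y = x₁ := by
      intro x y h
      by_cases hx : x ∈ B₀
      · rw [prem₀' x hx] at h
        exact ⟨hx, by simpa using h⟩
      · simp [prem₀ x hx] at h
    -- A path that alternates forever is traced by `c` in `G₀` and `c'` in `G₁`. Passing to `G₁`
    -- progresses because of `c' < c`; passing back is a substitution that maps `c` to `c'`, so `c`
    -- is a precursor of `c'`.
    let τ : G₀.Node ⊕ G₁.Node → Tm := Sum.elim (fun _ => v c) fun _ => v c'
    have prog : ∀ i x y, b i = .inl x → b (i + 1) = .inr y →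
        Progresses (fun i => seq (b i)) (fun i => rule (b i)) (fun i => τ (b i)) i := by
      intro i x y hx hy
      have := hb i
      rw [hx, hy] at this
      obtain ⟨hB, hy'⟩ := cross x y this
      refine ⟨v c, ?_, ?_⟩
      · simp only [hx, rule₀' x hB]
        exact Or.inr rfl
      · simp only [hy]
        change lt (v c') (v c) ∈ (G₁.seq y).ant
        rw [hy', hx₁]
        exact hlt
    refine ⟨0, fun i => τ (b i), fun i _ => ⟨?_, ?_⟩, ?_⟩
    · dsimp only
      rcases hx : b i with x | x
      · exact (G₀.admissible x).occurs (Finset.mem_insert_self _ _)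
      · exact (G₁.admissible x).occurs (Finset.mem_insert_self _ _)
    · rcases hx : b i with x | x <;> rcases hy : b (i + 1) with y | y
      · left
        simp only [hx, hy]
        by_cases hB : x ∈ B₀
        · rw [rule₀' x hB]; exact Or.inr rfl
        · rw [rule₀ x hB]; exact G₀.precedes_self x (Finset.mem_insert_self _ _)
      · exact Or.inr (prog i x y hx hy)
      · left
        have := hb i
        simp only [hx, hy] at this ⊢
        by_cases hB : x ∈ B₁
        · rw [rule₁' x hB]
          exact (hθ ⟨x, hB⟩).1.symm
        · simp [prem₁ x hB] at this
      · left
        have := hb i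
        simp only [hx, hy] at this ⊢
        by_cases hB : x ∈ B₁
        · simp [prem₁' x hB] at this
        · rw [rule₁ x hB]; exact G₁.precedes_self x (Finset.mem_insert_self _ _)
    · intro m
      -- The path is in `G₀` at some time after `m`. Without later progress it would remain there.
      obtain ⟨i, hi, hi'⟩ := e₁ m
      by_contra! hno
      obtain ⟨j, hj, hj'⟩ := e₀ i
      refine hj' ?_
      clear hj'
      induction j, hj using Nat.le_induction with
      | base =>
        rcases hx : b i with x | x
        · exact ⟨x, rfl⟩
        · exact absurd ⟨x, hx.symm⟩ hi'
      | succ j hj ih =>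
        obtain ⟨x, hx⟩ := ih
        rcases hy : b (j + 1) with y | y
        · exact ⟨y, rfl⟩
        · exact absurd (prog j x y hx.symm hy) (hno j (by omega))
  refine ⟨{
      Node := G₀.Node ⊕ G₁.Node
      finite := inferInstance
      seq := seq
      rule := rule
      prem := prem
      leaf := {y | y.elim (fun y => y ∈ G₀.leaf ∧ y ∉ B₀) fun y => y ∈ G₁.leaf ∧ y ∉ B₁}
      correct := ?_
      leaf_prem := ?_
      leaf_seq := ?_
      admissible := ?_
      fixes := ?_
      good := good }, .inl x₀, rfl⟩
  · rintro (y | y) hy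
    · by_cases hB : y ∈ B₀
      · rw [rule₀' y hB, prem₀' y hB]
        change Infers none [G₁.seq x₁] (G₀.seq y)
        rw [show G₁.seq x₁ = G₀.seq y from hx₁.trans hB.2.symm]
        exact Infers.repeat _
      · rw [rule₀ y hB, prem₀ y hB, List.map_map]
        exact G₀.correct y fun hl => hy ⟨hl, hB⟩
    · by_cases hB : y ∈ B₁
      · rw [rule₁' y hB, prem₁' y hB]
        have := Infers.sub (θ ⟨y, hB⟩) (G₀.seq x₀).ant (G₀.seq x₀).suc
        change Infers _ [G₀.seq x₀] (G₁.seq y)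
        rw [(hθ ⟨y, hB⟩).2.2]
        exact this
      · rw [rule₁ y hB, prem₁ y hB, List.map_map]
        exact G₁.correct y fun hl => hy ⟨hl, hB⟩
  · rintro (y | y) hy
    · rw [prem₀ y hy.2, G₀.leaf_prem y hy.1, List.map_nil]
    · rw [prem₁ y hy.2, G₁.leaf_prem y hy.1, List.map_nil]
  · rintro (y | y) ⟨hl, hB⟩
    · exact (G₀.leaf_seq y hl).resolve_right fun e => hB ⟨hl, e⟩
    · exact (G₁.leaf_seq y hl).resolve_right fun e => hB ⟨hl, e⟩
  · rintro (y | y)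
    · exact (G₀.admissible y).mono (Finset.subset_insert _ _)
    · exact (G₁.admissible y).mono (Finset.subset_insert _ _)
  · rintro (y | y) ξ hξ p hp
    · by_cases hB : y ∈ B₀
      · rw [rule₀' y hB] at hξ; cases hξ
      · rw [rule₀ y hB] at hξ
        exact G₀.fixes y ξ hξ p (Finset.mem_insert_of_mem hp)
    · by_cases hB : y ∈ B₁
      · rw [rule₁' y hB] at hξ
        cases hξ
        exact (hθ ⟨y, hB⟩).2.1 p hp
      · rw [rule₁ y hB] at hξ
        exact G₁.fixes y ξ hξ p (Finset.mem_insert_of_mem hp)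

/-- A derivation without open leaves is a cyclic proof. -/
theorem closure_mem (h : Derives Φ P ∅ S) : S.toForm.closure ∈ CTheory Φ := by
  obtain ⟨G, x, rfl⟩ := h
  refine ⟨⟨G.Node, x, G.seq, G.rule, G.prem, fun y => G.correct y fun hy => G.leaf_seq y hy⟩,
    ⟨G.finite, fun b hb => ?_⟩, fun y φ hφ => (G.admissible y).2 φ hφ, rfl⟩
  obtain ⟨n, t, h₁, h₂⟩ := G.good b hb.2
  exact ⟨n, t, h₁, h₂⟩

end Derives

theorem insert_eq_self {φ : Form} {Γ : Finset Form} (h : φ ∈ Γ) : insert φ Γ = Γ :=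
  Finset.insert_eq_of_mem h

theorem exists_fresh (S : Sequent) : ∃ a, S.Fresh a := by
  obtain ⟨a, ha⟩ := Infinite.exists_notMem_finset ((S.ant ∪ S.suc).biUnion freeVars)
  exact ⟨a, fun φ hφ h => ha (Finset.mem_biUnion.2 ⟨φ, hφ, h⟩)⟩

namespace Sequent.Admissible

variable {Φ : Set Form} {P : Finset ℕ} {Γ Δ : Finset Form} {φ : Form}

theorem of_insert_suc (h : (⟨Γ, insert φ Δ⟩ : Sequent).Admissible Φ P) :
    (⟨Γ, Δ⟩ : Sequent).Admissible Φ P :=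
  ⟨h.1, fun ψ hψ => h.2 ψ (Finset.union_subset_union_right (Finset.subset_insert _ _) hψ)⟩

theorem insert_suc (h : (⟨Γ, Δ⟩ : Sequent).Admissible Φ P) (hφ : φ ∈ Φ) :
    (⟨Γ, insert φ Δ⟩ : Sequent).Admissible Φ P := by
  refine ⟨h.1, fun ψ hψ => ?_⟩
  rcases Finset.mem_union.1 hψ with hψ | hψ
  · exact h.2 ψ (Finset.mem_union_left _ hψ)
  · rcases Finset.mem_insert.1 hψ with rfl | hψ
    · exact hφ
    · exact h.2 ψ (Finset.mem_union_right _ hψ)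

theorem insert_ant (h : (⟨Γ, Δ⟩ : Sequent).Admissible Φ P) (hφ : φ ∈ Φ) :
    (⟨insert φ Γ, Δ⟩ : Sequent).Admissible Φ P := by
  refine ⟨fun p hp => Finset.mem_insert_of_mem (h.1 p hp), fun ψ hψ => ?_⟩
  rcases Finset.mem_union.1 hψ with hψ | hψ
  · rcases Finset.mem_insert.1 hψ with rfl | hψ
    · exact hφ
    · exact h.2 ψ (Finset.mem_union_left _ hψ)
  · exact h.2 ψ (Finset.mem_union_right _ hψ)

theorem mem_of_ant (h : (⟨Γ, Δ⟩ : Sequent).Admissible Φ P) (hφ : φ ∈ Γ) : φ ∈ Φ :=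
  h.2 φ (Finset.mem_union_left _ hφ)

theorem mem_of_suc (h : (⟨Γ, Δ⟩ : Sequent).Admissible Φ P) (hφ : φ ∈ Δ) : φ ∈ Φ :=
  h.2 φ (Finset.mem_union_right _ hφ)

end Sequent.Admissible

/-! ## Rules for derivations, with implicit contraction -/

namespace Derives

variable {Φ : Set Form} {P : Finset ℕ} {H : Set Sequent} {Γ Γ' Δ Δ' : Finset Form} {φ ψ : Form}

theorem infer {Ps : List Sequent} {S : Sequent} (h : Infers none Ps S) (ha : S.Admissible Φ P)
    (hP : ∀ T ∈ Ps, Derives Φ P H T) : Derives Φ P H S :=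
  step h (fun _ h => by cases h) ha hP

theorem cut (h₁ : Derives Φ P H ⟨Γ, insert φ Δ⟩) (h₂ : Derives Φ P H ⟨insert φ Γ, Δ⟩) :
    Derives Φ P H ⟨Γ, Δ⟩ :=
  infer (.cut φ Γ Δ) h₁.admissible.of_insert_suc (by simp [h₁, h₂])

theorem weaken (h : Derives Φ P H ⟨Γ, Δ⟩) (hΓ : Γ ⊆ Γ') (hΔ : Δ ⊆ Δ')
    (ha : (⟨Γ', Δ'⟩ : Sequent).Admissible Φ P) : Derives Φ P H ⟨Γ', Δ'⟩ :=
  infer (Infers.weaken hΓ hΔ) ha (by simp [h])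

theorem subst (hΦ : ClosedClass Φ) {S : Sequent} (h : Derives Φ P H S) {θ : Subst}
    (hθ : ∀ p ∈ P, θ p = v p) : Derives Φ P H (S.subst θ) := by
  refine step (.sub θ S.ant S.suc) (fun θ' e => by cases e; exact hθ) ⟨fun p hp => ?_, ?_⟩
    (by simpa using h)
  · refine Finset.mem_image.2 ⟨_, h.admissible.1 p hp, ?_⟩
    simp only [Form.subst, subst_v, hθ p hp]
  · intro φ hφ
    rcases Finset.mem_union.1 hφ with hφ | hφ <;> obtain ⟨ψ, hψ, rfl⟩ := Finset.mem_image.1 hφ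
    · exact hΦ.subst (h.admissible.2 ψ (Finset.mem_union_left _ hψ)) θ
    · exact hΦ.subst (h.admissible.2 ψ (Finset.mem_union_right _ hψ)) θ

theorem orL (h : φ.or ψ ∈ Γ) (ha : (⟨Γ, Δ⟩ : Sequent).Admissible Φ P)
    (h₁ : Derives Φ P H ⟨insert φ Γ, Δ⟩) (h₂ : Derives Φ P H ⟨insert ψ Γ, Δ⟩) :
    Derives Φ P H ⟨Γ, Δ⟩ := by
  have := Infers.orL φ ψ Γ Δ
  rw [insert_eq_self h] at this
  exact infer this ha (by simp [h₁, h₂])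

theorem orR₀ (h : φ.or ψ ∈ Δ) (h₁ : Derives Φ P H ⟨Γ, insert φ Δ⟩) : Derives Φ P H ⟨Γ, Δ⟩ := by
  have := Infers.orR₀ φ ψ Γ Δ
  rw [insert_eq_self h] at this
  exact infer this h₁.admissible.of_insert_suc (by simp [h₁])

theorem orR₁ (h : φ.or ψ ∈ Δ) (h₁ : Derives Φ P H ⟨Γ, insert ψ Δ⟩) : Derives Φ P H ⟨Γ, Δ⟩ := by
  have := Infers.orR₁ φ ψ Γ Δ
  rw [insert_eq_self h] at this
  exact infer this h₁.admissible.of_insert_suc (by simp [h₁])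

theorem andL₀ (h : φ.and ψ ∈ Γ) (ha : (⟨Γ, Δ⟩ : Sequent).Admissible Φ P)
    (h₁ : Derives Φ P H ⟨insert φ Γ, Δ⟩) : Derives Φ P H ⟨Γ, Δ⟩ := by
  have := Infers.andL₀ φ ψ Γ Δ
  rw [insert_eq_self h] at this
  exact infer this ha (by simp [h₁])

theorem andL₁ (h : φ.and ψ ∈ Γ) (ha : (⟨Γ, Δ⟩ : Sequent).Admissible Φ P)
    (h₁ : Derives Φ P H ⟨insert ψ Γ, Δ⟩) : Derives Φ P H ⟨Γ, Δ⟩ := by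
  have := Infers.andL₁ φ ψ Γ Δ
  rw [insert_eq_self h] at this
  exact infer this ha (by simp [h₁])

theorem andR (h : φ.and ψ ∈ Δ) (h₁ : Derives Φ P H ⟨Γ, insert φ Δ⟩)
    (h₂ : Derives Φ P H ⟨Γ, insert ψ Δ⟩) : Derives Φ P H ⟨Γ, Δ⟩ := by
  have := Infers.andR φ ψ Γ Δ
  rw [insert_eq_self h] at this
  exact infer this h₁.admissible.of_insert_suc (by simp [h₁, h₂])

theorem exL (h : ex φ ∈ Γ) (ha : (⟨Γ, Δ⟩ : Sequent).Admissible Φ P) {a : ℕ}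
    (hf : (⟨Γ, Δ⟩ : Sequent).Fresh a) (h₁ : Derives Φ P H ⟨insert (φ.inst (v a)) Γ, Δ⟩) :
    Derives Φ P H ⟨Γ, Δ⟩ := by
  have := Infers.exL φ a Γ Δ
  rw [insert_eq_self h] at this
  exact infer (this hf) ha (by simp [h₁])

theorem exR (h : ex φ ∈ Δ) (t : Tm) (h₁ : Derives Φ P H ⟨Γ, insert (φ.inst t) Δ⟩) :
    Derives Φ P H ⟨Γ, Δ⟩ := by
  have := Infers.exR φ t Γ Δ
  rw [insert_eq_self h] at this
  exact infer this h₁.admissible.of_insert_suc (by simp [h₁])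

theorem allL (h : all φ ∈ Γ) (ha : (⟨Γ, Δ⟩ : Sequent).Admissible Φ P) (t : Tm)
    (h₁ : Derives Φ P H ⟨insert (φ.inst t) Γ, Δ⟩) : Derives Φ P H ⟨Γ, Δ⟩ := by
  have := Infers.allL φ t Γ Δ
  rw [insert_eq_self h] at this
  exact infer this ha (by simp [h₁])

theorem allR (h : all φ ∈ Δ) {a : ℕ} (hf : (⟨Γ, Δ⟩ : Sequent).Fresh a)
    (h₁ : Derives Φ P H ⟨Γ, insert (φ.inst (v a)) Δ⟩) : Derives Φ P H ⟨Γ, Δ⟩ := by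
  have := Infers.allR φ a Γ Δ
  rw [insert_eq_self h] at this
  exact infer (this hf) h₁.admissible.of_insert_suc (by simp [h₁])

end Derives

/-! ## Sequents that are derivable in every context -/

/-- Every weakening of `Γ ⇒ Δ` with formulae in `Φ` is derivable, in every context. -/
def Pure (Φ : Set Form) (Γ Δ : Finset Form) : Prop :=
  ∀ (P : Finset ℕ) (H : Set Sequent) (Γ' Δ' : Finset Form), Γ ⊆ Γ' → Δ ⊆ Δ' →
    (⟨Γ', Δ'⟩ : Sequent).Admissible Φ P → Derives Φ P H ⟨Γ', Δ'⟩

namespace Pure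

variable {Φ : Set Form} {Γ Γ' Δ Δ' : Finset Form} {φ ψ : Form}

theorem mono (h : Pure Φ Γ Δ) (hΓ : Γ ⊆ Γ') (hΔ : Δ ⊆ Δ') : Pure Φ Γ' Δ' :=
  fun P H _ _ h₁ h₂ => h P H _ _ (hΓ.trans h₁) (hΔ.trans h₂)

theorem of_infers (h : ∀ Γ' Δ', Γ ⊆ Γ' → Δ ⊆ Δ' → Infers none [] ⟨Γ', Δ'⟩) : Pure Φ Γ Δ :=
  fun _ _ _ _ h₁ h₂ ha => .infer (h _ _ h₁ h₂) ha (by simp)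

theorem id (h₁ : φ ∈ Γ) (h₂ : φ ∈ Δ) : Pure Φ Γ Δ := of_infers fun Γ' Δ' hΓ hΔ => by
  have := Infers.id φ Γ' Δ'
  rwa [insert_eq_self (hΓ h₁), insert_eq_self (hΔ h₂)] at this

theorem negL (h₁ : φ ∈ Γ) (h₂ : φ.neg ∈ Γ) : Pure Φ Γ Δ := of_infers fun Γ' Δ' hΓ _ => by
  have := Infers.negL φ Γ' Δ'
  rwa [insert_eq_self (hΓ h₂), insert_eq_self (hΓ h₁)] at this

theorem negR (h₁ : φ ∈ Δ) (h₂ : φ.neg ∈ Δ) : Pure Φ Γ Δ := of_infers fun Γ' Δ' _ hΔ => by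
  have := Infers.negR φ Γ' Δ'
  rwa [insert_eq_self (hΔ h₂), insert_eq_self (hΔ h₁)] at this

theorem eqRefl {t : Tm} (h : eq t t ∈ Δ) : Pure Φ Γ Δ := of_infers fun Γ' Δ' _ hΔ => by
  have := Infers.eqRefl t Γ' Δ'
  rwa [insert_eq_self (hΔ h)] at this

theorem ax {A : Form} (hA : QBounded A) {θ : Subst} (h : A.subst θ ∈ Δ) : Pure Φ Γ Δ :=
  of_infers fun Γ' Δ' _ hΔ => by
    have := Infers.ax hA θ Γ' Δ'
    rwa [insert_eq_self (hΔ h)] at this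

theorem eqFunc {k : ℕ} {f : Func k} {s t : Fin k → Tm} (h : ∀ i, eq (s i) (t i) ∈ Γ)
    (h' : eq (Term.func f s) (Term.func f t) ∈ Δ) : Pure Φ Γ Δ := of_infers fun Γ' Δ' hΓ hΔ => by
  have := Infers.eqFunc f s t Γ' Δ'
  rwa [insert_eq_self (hΔ h'), Finset.union_eq_left.2] at this
  intro φ hφ
  obtain ⟨i, -, rfl⟩ := Finset.mem_image.1 hφ
  exact hΓ (h i)

theorem eqEq {s₁ s₂ t₁ t₂ : Tm} (h₁ : eq s₁ t₁ ∈ Γ) (h₂ : eq s₂ t₂ ∈ Γ) (h₃ : eq s₁ s₂ ∈ Γ)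
    (h₄ : eq t₁ t₂ ∈ Δ) : Pure Φ Γ Δ := of_infers fun Γ' Δ' hΓ hΔ => by
  have := Infers.eqEq s₁ s₂ t₁ t₂ Γ' Δ'
  rwa [insert_eq_self (hΔ h₄), Finset.union_eq_left.2] at this
  simp [Finset.insert_subset_iff, hΓ h₁, hΓ h₂, hΓ h₃]

theorem eqLt {s₁ s₂ t₁ t₂ : Tm} (h₁ : eq s₁ t₁ ∈ Γ) (h₂ : eq s₂ t₂ ∈ Γ) (h₃ : lt s₁ s₂ ∈ Γ)
    (h₄ : lt t₁ t₂ ∈ Δ) : Pure Φ Γ Δ := of_infers fun Γ' Δ' hΓ hΔ => by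
  have := Infers.eqLt s₁ s₂ t₁ t₂ Γ' Δ'
  rwa [insert_eq_self (hΔ h₄), Finset.union_eq_left.2] at this
  simp [Finset.insert_subset_iff, hΓ h₁, hΓ h₂, hΓ h₃]

theorem cut (hφ : φ ∈ Φ) (h₁ : Pure Φ Γ (insert φ Δ)) (h₂ : Pure Φ (insert φ Γ) Δ) :
    Pure Φ Γ Δ := fun P H _ _ hΓ hΔ ha =>
  .cut (φ := φ) (h₁ P H _ _ hΓ (Finset.insert_subset_insert _ hΔ) (ha.insert_suc hφ))
    (h₂ P H _ _ (Finset.insert_subset_insert _ hΓ) hΔ (ha.insert_ant hφ))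

theorem cuts (F : Finset Form) (hF : ∀ φ ∈ F, φ ∈ Φ) (h₁ : ∀ φ ∈ F, Pure Φ Γ (insert φ Δ))
    (h₂ : Pure Φ (Γ ∪ F) Δ) : Pure Φ Γ Δ := by
  induction F using Finset.induction_on with
  | empty => simpa using h₂
  | insert φ F _ ih =>
    refine ih (fun ψ hψ => hF ψ (Finset.mem_insert_of_mem hψ))
      (fun ψ hψ => h₁ ψ (Finset.mem_insert_of_mem hψ)) (cut (hF φ (Finset.mem_insert_self _ _))
      ((h₁ φ (Finset.mem_insert_self _ _)).mono Finset.subset_union_left (Finset.Subset.refl _)) ?_)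
    rwa [Finset.union_insert] at h₂

variable (hΦ : ClosedClass Φ)
include hΦ

theorem orL (h : φ.or ψ ∈ Γ) (h₁ : Pure Φ (insert φ Γ) Δ) (h₂ : Pure Φ (insert ψ Γ) Δ) :
    Pure Φ Γ Δ := fun P H _ _ hΓ hΔ ha =>
  .orL (hΓ h) ha
    (h₁ P H _ _ (Finset.insert_subset_insert _ hΓ) hΔ
      (ha.insert_ant (hΦ.or_left (ha.mem_of_ant (hΓ h)))))
    (h₂ P H _ _ (Finset.insert_subset_insert _ hΓ) hΔ
      (ha.insert_ant (hΦ.or_right (ha.mem_of_ant (hΓ h)))))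

theorem orR (h : φ.or ψ ∈ Δ) (h₁ : Pure Φ Γ (insert φ (insert ψ Δ))) : Pure Φ Γ Δ :=
  fun P H _ Δ' hΓ hΔ ha => by
  have hψ := hΦ.or_right (ha.mem_of_suc (hΔ h))
  have hφ := hΦ.or_left (ha.mem_of_suc (hΔ h))
  exact .orR₁ (hΔ h) (.orR₀ (Finset.mem_insert_of_mem (hΔ h)) (h₁ P H _ _ hΓ
    (Finset.insert_subset_insert _ (Finset.insert_subset_insert _ hΔ))
    ((ha.insert_suc hψ).insert_suc hφ)))

theorem andL (h : φ.and ψ ∈ Γ) (h₁ : Pure Φ (insert φ (insert ψ Γ)) Δ) : Pure Φ Γ Δ :=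
  fun P H _ Δ' hΓ hΔ ha => by
  have hψ := hΦ.and_right (ha.mem_of_ant (hΓ h))
  have hφ := hΦ.and_left (ha.mem_of_ant (hΓ h))
  exact .andL₁ (hΓ h) ha (.andL₀ (Finset.mem_insert_of_mem (hΓ h)) (ha.insert_ant hψ)
    (h₁ P H _ _ (Finset.insert_subset_insert _ (Finset.insert_subset_insert _ hΓ)) hΔ
      ((ha.insert_ant hψ).insert_ant hφ)))

theorem andR (h : φ.and ψ ∈ Δ) (h₁ : Pure Φ Γ (insert φ Δ)) (h₂ : Pure Φ Γ (insert ψ Δ)) :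
    Pure Φ Γ Δ := fun P H _ _ hΓ hΔ ha =>
  .andR (hΔ h)
    (h₁ P H _ _ hΓ (Finset.insert_subset_insert _ hΔ)
      (ha.insert_suc (hΦ.and_left (ha.mem_of_suc (hΔ h)))))
    (h₂ P H _ _ hΓ (Finset.insert_subset_insert _ hΔ)
      (ha.insert_suc (hΦ.and_right (ha.mem_of_suc (hΔ h)))))

/-- The eigenvariable has to be fresh for the weakened sequent, which is not known here, so the
premiss is required for every variable. -/
theorem exL (h : ex φ ∈ Γ) (h₁ : ∀ a, Pure Φ (insert (φ.inst (v a)) Γ) Δ) : Pure Φ Γ Δ :=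
  fun P H Γ' Δ' hΓ hΔ ha => by
  obtain ⟨a, hf⟩ := exists_fresh ⟨Γ', Δ'⟩
  exact .exL (hΓ h) ha hf (h₁ a P H _ _ (Finset.insert_subset_insert _ hΓ) hΔ
    (ha.insert_ant (hΦ.subst (hΦ.ex_body (ha.mem_of_ant (hΓ h))) _)))

theorem exR (h : ex φ ∈ Δ) (t : Tm) (h₁ : Pure Φ Γ (insert (φ.inst t) Δ)) : Pure Φ Γ Δ :=
  fun P H _ _ hΓ hΔ ha =>
  .exR (hΔ h) t (h₁ P H _ _ hΓ (Finset.insert_subset_insert _ hΔ)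
    (ha.insert_suc (hΦ.subst (hΦ.ex_body (ha.mem_of_suc (hΔ h))) _)))

theorem allL (h : all φ ∈ Γ) (t : Tm) (h₁ : Pure Φ (insert (φ.inst t) Γ) Δ) : Pure Φ Γ Δ :=
  fun P H _ _ hΓ hΔ ha =>
  .allL (hΓ h) ha t (h₁ P H _ _ (Finset.insert_subset_insert _ hΓ) hΔ
    (ha.insert_ant (hΦ.subst (hΦ.all_body (ha.mem_of_ant (hΓ h))) _)))

theorem allR (h : all φ ∈ Δ) (h₁ : ∀ a, Pure Φ Γ (insert (φ.inst (v a)) Δ)) : Pure Φ Γ Δ :=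
  fun P H Γ' Δ' hΓ hΔ ha => by
  obtain ⟨a, hf⟩ := exists_fresh ⟨Γ', Δ'⟩
  exact .allR (hΔ h) hf (h₁ a P H _ _ hΓ (Finset.insert_subset_insert _ hΔ)
    (ha.insert_suc (hΦ.subst (hΦ.all_body (ha.mem_of_suc (hΔ h))) _)))

theorem symm {s t : Tm} (h : eq s t ∈ Γ) (h' : eq t s ∈ Δ) : Pure Φ Γ Δ :=
  cut (hΦ.bounded (.eq s s)) (eqRefl (Finset.mem_insert_self _ _))
    (eqEq (s₁ := s) (s₂ := s) (Finset.mem_insert_of_mem h) (Finset.mem_insert_self _ _)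
      (Finset.mem_insert_self _ _) h')

theorem trans {s t u : Tm} (h₁ : eq s t ∈ Γ) (h₂ : eq t u ∈ Γ) (h' : eq s u ∈ Δ) : Pure Φ Γ Δ :=
  cut (hΦ.bounded (.eq s s)) (eqRefl (Finset.mem_insert_self _ _))
    (eqEq (s₁ := s) (s₂ := t) (Finset.mem_insert_self _ _) (Finset.mem_insert_of_mem h₂)
      (Finset.mem_insert_of_mem h₁) h')

theorem tm_congr {θ₁ θ₂ : Subst} (hE : ∀ x, θ₁ x = θ₂ x ∨ eq (θ₁ x) (θ₂ x) ∈ Γ) (t : Tm) :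
    ∀ {Δ}, eq (t.subst θ₁) (t.subst θ₂) ∈ Δ → Pure Φ Γ Δ := by
  induction t with
  | var x =>
    intro Δ h
    rcases hE x with e | e
    · refine eqRefl (t := θ₁ x) ?_
      simpa [Term.subst, ← e] using h
    · exact id e h
  | func f ts ih =>
    intro Δ h
    refine cuts (Finset.univ.image fun i => eq ((ts i).subst θ₁) ((ts i).subst θ₂)) ?_ ?_ ?_
    · intro φ hφ
      obtain ⟨i, -, rfl⟩ := Finset.mem_image.1 hφ
      exact hΦ.bounded (.eq _ _)
    · intro φ hφ
      obtain ⟨i, -, rfl⟩ := Finset.mem_image.1 hφ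
      exact ih i (Finset.mem_insert_self _ _)
    · exact eqFunc (fun i => Finset.mem_union_right _ (Finset.mem_image_of_mem _ (Finset.mem_univ i))) h

/-- Equal terms may be substituted for one another. -/
theorem congr : ∀ {φ : Form}, φ ∈ Φ → ∀ {θ₁ θ₂ : Subst} {Γ Δ : Finset Form},
    (∀ x, θ₁ x = θ₂ x ∨ (eq (θ₁ x) (θ₂ x) ∈ Γ ∧ eq (θ₂ x) (θ₁ x) ∈ Γ)) →
    φ.subst θ₁ ∈ Γ → φ.subst θ₂ ∈ Δ → Pure Φ Γ Δ := by
  have term : ∀ {θ₁ θ₂ : Subst} {Γ Δ : Finset Form} (s t : Tm),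
      (∀ x, θ₁ x = θ₂ x ∨ (eq (θ₁ x) (θ₂ x) ∈ Γ ∧ eq (θ₂ x) (θ₁ x) ∈ Γ)) →
      Pure Φ (insert (eq (s.subst θ₁) (t.subst θ₁)) Γ) (insert (eq (s.subst θ₂) (t.subst θ₂)) Δ) ∧
      Pure Φ (insert (lt (s.subst θ₁) (t.subst θ₁)) Γ)
        (insert (lt (s.subst θ₂) (t.subst θ₂)) Δ) := by
    intro θ₁ θ₂ Γ Δ s t hE
    have h : ∀ (ψ : Form) (Δ), Pure Φ
        (insert ψ Γ ∪ {eq (s.subst θ₁) (s.subst θ₂), eq (t.subst θ₁) (t.subst θ₂)}) Δ →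
        Pure Φ (insert ψ Γ) Δ := by
      intro ψ Δ hp
      refine cuts _ ?_ ?_ hp
      · simpa using ⟨hΦ.bounded (.eq _ _), hΦ.bounded (.eq _ _)⟩
      · have hE' : ∀ x, θ₁ x = θ₂ x ∨ eq (θ₁ x) (θ₂ x) ∈ insert ψ Γ := fun x =>
          (hE x).imp_right fun h => Finset.mem_insert_of_mem h.1
        simp only [Finset.mem_insert, Finset.mem_singleton, forall_eq_or_imp, forall_eq]
        exact ⟨tm_congr hΦ hE' s (Finset.mem_insert_self _ _),
          tm_congr hΦ hE' t (Finset.mem_insert_self _ _)⟩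
    exact ⟨h _ _ (eqEq (s₁ := s.subst θ₁) (s₂ := t.subst θ₁) (by simp) (by simp) (by simp)
        (Finset.mem_insert_self _ _)),
      h _ _ (eqLt (s₁ := s.subst θ₁) (s₂ := t.subst θ₁) (by simp) (by simp) (by simp)
        (Finset.mem_insert_self _ _))⟩
  have symm' : ∀ {θ₁ θ₂ : Subst} {Γ : Finset Form},
      (∀ x, θ₁ x = θ₂ x ∨ (eq (θ₁ x) (θ₂ x) ∈ Γ ∧ eq (θ₂ x) (θ₁ x) ∈ Γ)) →
      ∀ x, θ₂ x = θ₁ x ∨ (eq (θ₂ x) (θ₁ x) ∈ Γ ∧ eq (θ₁ x) (θ₂ x) ∈ Γ) :=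
    fun hE x => (hE x).imp Eq.symm And.symm
  have weak : ∀ {θ₁ θ₂ : Subst} {Γ Γ' : Finset Form}, Γ ⊆ Γ' →
      (∀ x, θ₁ x = θ₂ x ∨ (eq (θ₁ x) (θ₂ x) ∈ Γ ∧ eq (θ₂ x) (θ₁ x) ∈ Γ)) →
      ∀ x, θ₁ x = θ₂ x ∨ (eq (θ₁ x) (θ₂ x) ∈ Γ' ∧ eq (θ₂ x) (θ₁ x) ∈ Γ') :=
    fun h hE x => (hE x).imp_right (And.imp (fun e => h e) fun e => h e)
  have binder : ∀ {θ₁ θ₂ : Subst} {Γ : Finset Form} (a : Tm),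
      (∀ x, θ₁ x = θ₂ x ∨ (eq (θ₁ x) (θ₂ x) ∈ Γ ∧ eq (θ₂ x) (θ₁ x) ∈ Γ)) →
      ∀ x, scons a θ₁ x = scons a θ₂ x ∨
        (eq (scons a θ₁ x) (scons a θ₂ x) ∈ Γ ∧ eq (scons a θ₂ x) (scons a θ₁ x) ∈ Γ) := by
    intro θ₁ θ₂ Γ a hE x
    cases x with
    | zero => exact Or.inl rfl
    | succ x => exact hE x
  intro φ
  induction φ with
  | eq s t =>
    intro _ θ₁ θ₂ Γ Δ hE h₁ h₂
    have := (term (Δ := Δ) s t hE).1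
    rw [insert_eq_self, insert_eq_self] at this
    exacts [this, h₂, h₁]
  | lt s t =>
    intro _ θ₁ θ₂ Γ Δ hE h₁ h₂
    have := (term (Δ := Δ) s t hE).2
    rw [insert_eq_self, insert_eq_self] at this
    exacts [this, h₂, h₁]
  | neq s t =>
    intro _ θ₁ θ₂ Γ Δ hE h₁ h₂
    -- Negated atoms are treated contrapositively, by rewriting the atom from `θ₂` back to `θ₁`.
    -- This is why the equations are needed in both directions.
    refine cut (φ := eq (s.subst θ₂) (t.subst θ₂)) (hΦ.bounded (.eq _ _))
      (negR (φ := eq (s.subst θ₂) (t.subst θ₂)) (by simp) (Finset.mem_insert_of_mem h₂)) ?_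
    exact cut (φ := eq (s.subst θ₁) (t.subst θ₁)) (hΦ.bounded (.eq _ _)) (term s t (symm' hE)).1
      (negL (φ := eq (s.subst θ₁) (t.subst θ₁)) (by simp)
        (Finset.mem_insert_of_mem (Finset.mem_insert_of_mem h₁)))
  | nlt s t =>
    intro _ θ₁ θ₂ Γ Δ hE h₁ h₂
    refine cut (φ := lt (s.subst θ₂) (t.subst θ₂)) (hΦ.bounded (.lt _ _))
      (negR (φ := lt (s.subst θ₂) (t.subst θ₂)) (by simp) (Finset.mem_insert_of_mem h₂)) ?_
    exact cut (φ := lt (s.subst θ₁) (t.subst θ₁)) (hΦ.bounded (.lt _ _)) (term s t (symm' hE)).2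
      (negL (φ := lt (s.subst θ₁) (t.subst θ₁)) (by simp)
        (Finset.mem_insert_of_mem (Finset.mem_insert_of_mem h₁)))
  | and φ ψ ih₁ ih₂ =>
    intro h θ₁ θ₂ Γ Δ hE h₁ h₂
    have hE' := weak ((Finset.subset_insert (ψ.subst θ₁) Γ).trans
      (Finset.subset_insert (φ.subst θ₁) _)) hE
    exact andL hΦ h₁ (andR hΦ h₂ (ih₁ (hΦ.and_left h) hE' (by simp) (by simp))
      (ih₂ (hΦ.and_right h) hE' (by simp) (by simp)))
  | or φ ψ ih₁ ih₂ =>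
    intro h θ₁ θ₂ Γ Δ hE h₁ h₂
    exact orR hΦ h₂ (orL hΦ h₁
      (ih₁ (hΦ.or_left h) (weak (Finset.subset_insert _ Γ) hE) (by simp) (by simp))
      (ih₂ (hΦ.or_right h) (weak (Finset.subset_insert _ Γ) hE) (by simp) (by simp)))
  | all φ ih =>
    intro h θ₁ θ₂ Γ Δ hE h₁ h₂
    refine allR hΦ h₂ fun a => allL hΦ h₁ (v a) ?_
    have := @ih (hΦ.all_body h) _ _ _
      (insert ((φ.subst (up θ₂)).inst (v a)) Δ)
      (weak (Finset.subset_insert ((φ.subst (up θ₁)).inst (v a)) Γ) (binder (v a) hE))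
    rw [subst_up_inst, subst_up_inst] at this
    rw [← up, ← up, subst_up_inst, subst_up_inst]
    exact this (by simp) (by simp)
  | ex φ ih =>
    intro h θ₁ θ₂ Γ Δ hE h₁ h₂
    refine exL hΦ h₁ fun a => exR hΦ h₂ (v a) ?_
    have := @ih (hΦ.ex_body h) _ _ _
      (insert ((φ.subst (up θ₂)).inst (v a)) Δ)
      (weak (Finset.subset_insert ((φ.subst (up θ₁)).inst (v a)) Γ) (binder (v a) hE))
    rw [subst_up_inst, subst_up_inst] at this
    rw [← up, ← up, subst_up_inst, subst_up_inst]
    exact this (by simp) (by simp)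

/-- In the induction cycle this carries σ from zero or a successor to the variable `c` equal to it.
The opposite orientation of the equation, which `congr` needs, is cut in. -/
theorem replace {s t : Tm} (hst : eq t s ∈ Γ) (hφ : φ ∈ Φ) {θ₁ θ₂ : Subst}
    (hE : ∀ x, θ₁ x = θ₂ x ∨ (θ₁ x = s ∧ θ₂ x = t)) (h₁ : φ.subst θ₁ ∈ Γ)
    (h₂ : φ.subst θ₂ ∈ Δ) : Pure Φ Γ Δ := by
  refine cut (hΦ.bounded (.eq s t)) (symm hΦ hst (Finset.mem_insert_self _ _))
    (congr hΦ hφ (fun x => (hE x).imp_right ?_) (Finset.mem_insert_of_mem h₁) h₂)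
  rintro ⟨e₁, e₂⟩
  rw [e₁, e₂]
  exact ⟨Finset.mem_insert_self _ _, Finset.mem_insert_of_mem hst⟩

end Pure

/-! ## Free variables of instances -/

theorem mem_varFinset_subst {t : Tm} {θ : Subst} {x : ℕ} (h : x ∈ (t.subst θ).varFinset) :
    ∃ i ∈ t.varFinset, x ∈ (θ i).varFinset := by
  induction t with
  | var i => exact ⟨i, by simp [Term.varFinset], h⟩
  | func f ts ih =>
    simp only [Term.subst, Term.varFinset, Finset.mem_biUnion] at h
    obtain ⟨j, -, hj⟩ := h
    obtain ⟨i, hi, hx⟩ := ih j hj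
    exact ⟨i, by simp only [Term.varFinset, Finset.mem_biUnion]; exact ⟨j, by simp, hi⟩, hx⟩

theorem varFinset_lift {t : Tm} {x : ℕ} (h : x ∈ (lift t).varFinset) :
    ∃ y ∈ t.varFinset, x = y + 1 := by
  have e : lift t = t.subst fun n => v (n + 1) := by
    have := tm_subst_relabel t Nat.succ v
    rwa [tm_subst_v] at this
  rw [e] at h
  obtain ⟨i, hi, hx⟩ := mem_varFinset_subst h
  exact ⟨i, hi, by simpa [v, Term.varFinset] using hx⟩

theorem Form.mem_freeVars_subst {φ : Form} : ∀ {θ : Subst} {x : ℕ},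
    x ∈ (φ.subst θ).freeVars → ∃ i ∈ φ.freeVars, x ∈ (θ i).varFinset := by
  induction φ with
  | eq s t | neq s t | lt s t | nlt s t =>
    intro θ x h
    simp only [subst, freeVars, Finset.mem_union] at h ⊢
    rcases h with h | h <;> obtain ⟨i, hi, hx⟩ := mem_varFinset_subst h
    exacts [⟨i, Or.inl hi, hx⟩, ⟨i, Or.inr hi, hx⟩]
  | and φ ψ ih₁ ih₂ | or φ ψ ih₁ ih₂ =>
    intro θ x h
    simp only [subst, freeVars, Finset.mem_union] at h ⊢
    rcases h with h | h
    · obtain ⟨i, hi, hx⟩ := ih₁ h; exact ⟨i, Or.inl hi, hx⟩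
    · obtain ⟨i, hi, hx⟩ := ih₂ h; exact ⟨i, Or.inr hi, hx⟩
  | all φ ih | ex φ ih =>
    intro θ x h
    simp only [subst_all, subst_ex, freeVars, Finset.mem_image, Finset.mem_erase] at h ⊢
    obtain ⟨y, ⟨hy0, hy⟩, rfl⟩ := h
    obtain ⟨i, hi, hx⟩ := ih hy
    cases i with
    | zero =>
      have : y = 0 := by simpa [up, scons, v, Term.varFinset] using hx
      exact absurd this hy0
    | succ i =>
      obtain ⟨z, hz, rfl⟩ := varFinset_lift hx
      exact ⟨i, ⟨i + 1, ⟨by simp, hi⟩, rfl⟩, hz⟩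

/-- All free variables of `φ` are below `N`. -/
def Form.Below (N : ℕ) (φ : Form) : Prop := ∀ x ∈ φ.freeVars, x < N

theorem image_subst_eq_self {N : ℕ} {Γ : Finset Form} (hΓ : ∀ φ ∈ Γ, φ.Below N) {θ : Subst}
    (hθ : ∀ j < N, θ j = v j) : Γ.image (Form.subst θ) = Γ := by
  have e : Γ.image (Form.subst θ) = Γ.image fun φ => φ :=
    Finset.image_congr fun φ hφ => subst_eq_self fun x hx => hθ x (hΓ φ hφ x hx)
  rw [e, Finset.image_id']

/-- The instance of `σ` with `u` for the variables below `k` and `t` for the variable `k`; it is an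
instance of the matrix of `(all^[k] σ).inst t`. -/
def instBlk (k : ℕ) (σ : Form) (t : Tm) (u : Subst) : Form := σ.subst (blk k u (scons t v))

theorem instBlk_subst {N k : ℕ} {σ : Form} (hσ : σ.Below N) {t : Tm} {u θ : Subst}
    (hθ : ∀ j < N, θ j = v j) :
    (instBlk k σ t u).subst θ = instBlk k σ (t.subst θ) fun i => (u i).subst θ := by
  rw [instBlk, subst_subst]
  refine subst_congr fun x hx => ?_
  have hx := hσ x hx
  simp only [blk]
  split_ifs with h
  · rfl
  · cases e : x - k with
    | zero => rfl
    | succ j => exact hθ j (by omega)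

theorem mem_freeVars_instBlk {N k : ℕ} {σ : Form} (hσ : σ.Below N) {t : Tm} {u : Subst} {x : ℕ}
    (h : x ∈ (instBlk k σ t u).freeVars) :
    x < N ∨ x ∈ t.varFinset ∨ ∃ i, x ∈ (u i).varFinset := by
  obtain ⟨i, hi, hx⟩ := mem_freeVars_subst h
  have hi := hσ i hi
  simp only [blk] at hx
  split_ifs at hx with h
  · exact Or.inr (Or.inr ⟨i, hx⟩)
  · cases e : i - k with
    | zero => rw [e] at hx; exact Or.inr (Or.inl hx)
    | succ j =>
      rw [e] at hx
      have : x = j := by simpa [scons, v, Term.varFinset] using hx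
      exact Or.inl (by omega)

/-- Fixes the variables below `N`, and maps `N` to `s` and `N + 2 + i` to `u i`. -/
def reassign (N : ℕ) (s : Tm) (u : Subst) : Subst := fun j =>
  if j < N then v j else if j = N then s else u (j - (N + 2))

theorem reassign_lt {N : ℕ} {s : Tm} {u : Subst} : ∀ j < N, reassign N s u j = v j :=
  fun _ hj => if_pos hj

theorem reassign_self {N : ℕ} {s : Tm} {u : Subst} : reassign N s u N = s := by simp [reassign]

/-- The block starts at `N + 2` because `N` and `N + 1` are reserved for the cycle variables c and
c'. Truncated subtraction sends `N + 1` to `u 0`, which is harmless: the sequents to which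
`reassign` is applied do not contain that variable. -/
theorem reassign_add {N : ℕ} {s : Tm} {u : Subst} (i : ℕ) :
    reassign N s u (N + 2 + i) = u i := by
  simp [reassign, show ¬ N + 2 + i < N by omega, show ¬ N + 2 + i = N by omega]

/-- The variables `N + 2, N + 3, …`. -/
def above (N : ℕ) : Subst := fun i => v (N + 2 + i)

theorem instBlk_reassign {N k : ℕ} {σ : Form} (hσ : σ.Below N) {t s : Tm} {u : Subst} :
    (instBlk k σ t (above N)).subst (reassign N s u) =
      instBlk k σ (t.subst (reassign N s u)) u := by
  rw [instBlk_subst hσ reassign_lt]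
  congr 1
  funext i
  exact reassign_add i

/-! ## Universal hypotheses -/

/-- The sequents that are immediate from `Γ ⇒ Δ` together with universal hypotheses: a triple
`(k, σ, t)` in `U` stands for `(all^[k] σ).inst t`. -/
def leafSet (U : Set (ℕ × Form × Tm)) (Γ Δ : Finset Form) : Set Sequent :=
  {S | ∃ k σ t u, (k, σ, t) ∈ U ∧ Γ ⊆ S.ant ∧ insert (instBlk k σ t u) Δ ⊆ S.suc}

theorem leafSet_mono {U U' : Set (ℕ × Form × Tm)} {Γ Γ' Δ Δ' : Finset Form} (hU : U ⊆ U')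
    (hΓ : Γ' ⊆ Γ) (hΔ : Δ' ⊆ Δ) : leafSet U Γ Δ ⊆ leafSet U' Γ' Δ' := by
  rintro S ⟨k, σ, t, u, h, h₁, h₂⟩
  exact ⟨k, σ, t, u, hU h, hΓ.trans h₁, (Finset.insert_subset_insert _ hΔ).trans h₂⟩

/-- The sequent `Γ ⇒ Δ` is derivable from the universal hypotheses `U`. -/
def DerivesFrom (Φ : Set Form) (P : Finset ℕ) (U : Set (ℕ × Form × Tm)) (Γ Δ : Finset Form) : Prop :=
  Derives Φ P (leafSet U Γ Δ) ⟨Γ, Δ⟩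

theorem Sequent.Admissible.insert_var {Φ : Set Form} (hΦ : ClosedClass Φ) {P : Finset ℕ}
    {Γ Δ : Finset Form} (h : (⟨Γ, Δ⟩ : Sequent).Admissible Φ P) (p : ℕ) :
    (⟨insert (eq (v p) (v p)) Γ, Δ⟩ : Sequent).Admissible Φ (insert p P) := by
  refine ⟨fun q hq => ?_, (h.insert_ant (hΦ.bounded (.eq _ _))).2⟩
  rcases Finset.mem_insert.1 hq with rfl | hq
  · exact Finset.mem_insert_self _ _
  · exact Finset.mem_insert_of_mem (h.1 q hq)

namespace DerivesFrom

variable {Φ : Set Form} (hΦ : ClosedClass Φ) {P : Finset ℕ} {U : Set (ℕ × Form × Tm)}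
  {Γ Δ : Finset Form} {N k : ℕ} {σ : Form}
include hΦ

/-- Cut on a universal formula. -/
theorem cut_all (hP : ∀ p ∈ P, p < N) (hΓ : ∀ φ ∈ Γ, φ.Below N) (hΔ : ∀ φ ∈ Δ, φ.Below N)
    (hσ : σ.Below N) {t : Tm} (ht : ∀ x ∈ t.varFinset, x < N)
    (h₁ : DerivesFrom Φ P (insert (k, σ, t) U) Γ Δ)
    (h₂ : DerivesFrom Φ P U Γ (insert (instBlk k σ t (above N)) Δ)) : DerivesFrom Φ P U Γ Δ := by
  refine h₁.graft ?_
  rintro ⟨Γ', Δ'⟩ ⟨k', σ', t', u, hU, hΓ', hΔ'⟩ ha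
  rcases hU with e | hU
  · simp only [Prod.mk.injEq] at e
    obtain ⟨rfl, rfl, rfl⟩ := e
    -- This leaf demands σ(u, t). The variables `above N` in `h₂` are generic, so replacing them by
    -- `u` yields it; Γ, Δ, `t` and `P` live below `N` and are not changed.
    have := (Derives.mono h₂ (leafSet_mono (Set.Subset.refl _) (Finset.Subset.refl _)
      (Finset.subset_insert _ _))).subst hΦ (θ := reassign N (v N) u)
      fun p hp => reassign_lt p (hP p hp)
    simp only [Sequent.subst, Finset.image_insert, image_subst_eq_self hΓ reassign_lt,
      image_subst_eq_self hΔ reassign_lt, instBlk_reassign hσ] at this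
    rw [tm_subst_congr (θ' := v) fun x hx => reassign_lt x (ht x hx), tm_subst_v] at this
    exact this.weaken hΓ' hΔ' ha
  · exact .hyp ⟨k', σ', t', u, hU, hΓ', hΔ'⟩ ha

end DerivesFrom

-- Zero or successor, and induction by a cycle.

theorem subst_zero (θ : Subst) : zero.subst θ = zero := by
  simp only [zero, Term.subst]; congr 1; funext i; exact i.elim0

theorem subst_succ (t : Tm) (θ : Subst) : (succ t).subst θ = succ (t.subst θ) := by
  simp only [succ, Term.subst]; congr 1; funext i; fin_cases i; rfl

/-- The matrix of `∃ x < t. t = succ x`. -/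
def predBody (t : Tm) : Form := and (lt (v 0) (lift t)) (eq (lift t) (succ (v 0)))

theorem predBody_inst (t s : Tm) : (predBody t).inst s = and (lt s t) (eq t (succ s)) := by
  simp only [predBody, inst, subst, lift_subst_scons, subst_succ, tm_subst_v, subst_v]
  rfl

theorem bounded_predBody (t : Tm) : Bounded (ex (predBody t)) := .bex t (.eq _ _)

theorem mem_freeVars_predBody {t : Tm} {x : ℕ} (h : x ∈ (ex (predBody t)).freeVars) :
    x ∈ t.varFinset := by
  have key : ∀ y ∈ (predBody t).freeVars, y ≠ 0 → y ∈ (lift t).varFinset := by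
    intro y hy h0
    simp only [predBody, succ, v, freeVars, Term.varFinset, Finset.mem_union, Finset.mem_singleton,
      Finset.mem_biUnion] at hy
    rcases hy with (hy | hy) | hy | ⟨i, -, hy⟩
    · exact absurd hy h0
    · exact hy
    · exact hy
    · fin_cases i
      exact absurd (by simpa [Term.varFinset] using hy) h0
  simp only [freeVars, Finset.mem_image, Finset.mem_erase] at h
  obtain ⟨y, ⟨hy0, hy⟩, rfl⟩ := h
  obtain ⟨z, hz, rfl⟩ := varFinset_lift (key y hy hy0)
  exact hz

/-- Every number is zero or a successor. -/
theorem Pure.zero_or_succ {Φ : Set Form} {Γ Δ : Finset Form} {t : Tm}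
    (h : (eq t zero).or (ex (predBody t)) ∈ Δ) : Pure Φ Γ Δ := by
  refine Pure.ax .q3 (θ := fun _ => t) ?_
  have e : (imp (neq (v 0) zero) (bexLT (v 0) (eq (v 1) (succ (v 0))))).subst (fun _ => t) =
      (eq t zero).or (ex (predBody t)) := by
    simp only [imp, neg, bexLT, subst, subst_zero, subst_succ, predBody, subst_v]
    rfl
  rwa [e]

namespace DerivesFrom

variable {Φ : Set Form} (hΦ : ClosedClass Φ) {P : Finset ℕ} {U : Set (ℕ × Form × Tm)}
  {Γ Δ : Finset Form} {N k : ℕ} {σ : Form}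
include hΦ

/-- Induction for a universal formula, by a cycle. -/
theorem induction (hP : ∀ p ∈ P, p < N) (hΓ : ∀ φ ∈ Γ, φ.Below N) (hΔ : ∀ φ ∈ Δ, φ.Below N)
    (hσ : σ.Below N) (hσΦ : σ ∈ Φ)
    (h₀ : DerivesFrom Φ P U Γ (insert (instBlk k σ zero (above N)) Δ))
    (h₁ : DerivesFrom Φ (insert (N + 1) P) (insert (k, σ, v (N + 1)) U)
      (insert (eq (v (N + 1)) (v (N + 1))) Γ)
      (insert (instBlk k σ (succ (v (N + 1))) (above N)) Δ))
    {s : Tm} {u : Subst} (hs : instBlk k σ s u ∈ Δ) : DerivesFrom Φ P U Γ Δ := by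
  have ha : (⟨Γ, Δ⟩ : Sequent).Admissible Φ P := h₀.admissible.of_insert_suc
  have hI : ∀ s u, instBlk k σ s u ∈ Φ := fun s u => hΦ.subst hσΦ _
  have hB : ∀ {φ}, Bounded φ → φ ∈ Φ := hΦ.bounded
  have hsub : ∀ s u, Sequent.subst (reassign N s u)
      ⟨insert (eq (v N) (v N)) Γ, insert (instBlk k σ (v N) (above N)) Δ⟩ =
      ⟨insert (eq s s) Γ, insert (instBlk k σ s u) Δ⟩ := by
    intro s u
    simp only [Sequent.subst, Finset.image_insert, image_subst_eq_self hΓ reassign_lt,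
      image_subst_eq_self hΔ reassign_lt, instBlk_reassign hσ, Form.subst, subst_v, reassign_self]
  let c := v N
  let c' := v (N + 1)
  let H := leafSet U Γ Δ
  -- `Sb` is the leaf for c = 0, to be closed by `h₀`; `S₁` is the leaf for c = s c', where the
  -- cycle passes to its second half.
  let Sb : Sequent := ⟨insert (eq c c) Γ, insert (instBlk k σ zero (above N)) Δ⟩
  let S₁ : Sequent := ⟨insert (lt c' c) (insert (eq c (succ c')) (insert (eq c' c')
    (insert (eq c c) Γ))), insert (instBlk k σ c (above N)) Δ⟩
  have blkE : ∀ s t x, blk k (above N) (scons s v) x = blk k (above N) (scons t v) x ∨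
      (blk k (above N) (scons s v) x = s ∧ blk k (above N) (scons t v) x = t) := by
    intro s t x
    simp only [blk]
    split_ifs with h
    · exact Or.inl rfl
    · cases x - k with
      | zero => exact Or.inr ⟨rfl, rfl⟩
      | succ j => exact Or.inl rfl
  have outer : Derives Φ (insert N P) ((H ∪ {Sb}) ∪ {S₁})
      ⟨insert (eq c c) Γ, insert (instBlk k σ c (above N)) Δ⟩ := by
    have ha₀ := (ha.insert_var hΦ N).insert_suc (hI c (above N))
    have hor : (eq c zero).or (ex (predBody c)) ∈ Φ := hB (.or (.eq _ _) (bounded_predBody c))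
    have ha₁ := ha₀.insert_ant hor
    refine .cut (φ := (eq c zero).or (ex (predBody c))) (Pure.zero_or_succ
      (Finset.mem_insert_self _ _) _ _ _ _ (Finset.Subset.refl _) (Finset.Subset.refl _)
      (ha₀.insert_suc hor)) (.orL (Finset.mem_insert_self _ _) ha₁ ?_ ?_)
    · have ha₂ := ha₁.insert_ant (φ := eq c zero) (hB (.eq _ _))
      refine .cut (φ := instBlk k σ zero (above N)) ?_ ?_
      · refine Derives.weaken (Γ := Sb.ant) (Δ := Sb.suc)
          (.hyp (Or.inl (Or.inr rfl)) ((ha.insert_var hΦ N).insert_suc (hI _ _))) ?_ ?_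
          (ha₂.insert_suc (hI _ _))
        · exact (Finset.subset_insert _ _).trans (Finset.subset_insert _ _)
        · exact Finset.insert_subset_insert _ (Finset.subset_insert _ _)
      · exact Pure.replace hΦ (s := zero) (t := c) (by simp) hσΦ (blkE zero c)
          (Finset.mem_insert_self _ _) (Finset.mem_insert_self _ _) _ _ _ _
          (Finset.Subset.refl _) (Finset.Subset.refl _) (ha₂.insert_ant (hI _ _))
    · have ha₂ := ha₁.insert_ant (φ := ex (predBody c)) (hB (bounded_predBody c))
      have hc : ∀ x ∈ c.varFinset, x = N := fun x hx => by
        simpa [c, v, Term.varFinset] using hx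
      refine .exL (φ := predBody c) (a := N + 1) (Finset.mem_insert_self _ _) ha₂ ?_ ?_
      -- The variable `N + 1` is fresh: the side formulae lie below `N`, c is `N`, and the generic
      -- arguments start at `N + 2`.
      · intro φ hφ hx
        simp only [Finset.mem_union, Finset.mem_insert] at hφ
        have hpred : N + 1 ∉ (ex (predBody c)).freeVars := fun h => by
          have := hc _ (mem_freeVars_predBody h); omega
        rcases hφ with (rfl | rfl | rfl | hφ) | rfl | hφ
        · exact hpred hx
        · rcases Finset.mem_union.1 hx with hx | hx
          · rcases Finset.mem_union.1 hx with hx | hx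
            · have := hc _ hx; omega
            · simp [zero, Term.varFinset] at hx
          · exact hpred hx
        · rcases Finset.mem_union.1 hx with hx | hx <;> (have := hc _ hx; omega)
        · have := hΓ φ hφ _ hx; omega
        · rcases mem_freeVars_instBlk hσ hx with hx | hx | ⟨i, hx⟩
          · omega
          · have := hc _ hx; omega
          · have : N + 1 = N + 2 + i := by simpa [above, v, Term.varFinset] using hx
            omega
        · have := hΔ φ hφ _ hx; omega
      · rw [predBody_inst]
        have ha₃ := ha₂.insert_ant (φ := (lt c' c).and (eq c (succ c')))
          (hB (.and (.lt _ _) (.eq _ _)))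
        have ha₄ := ha₃.insert_ant (φ := eq c (succ c')) (hB (.eq _ _))
        have ha₅ := ha₄.insert_ant (φ := lt c' c) (hB (.lt _ _))
        have ha₆ := ha₅.insert_ant (φ := eq c' c') (hB (.eq _ _))
        refine .andL₁ (Finset.mem_insert_self _ _) ha₃ (.andL₀
          (Finset.mem_insert_of_mem (Finset.mem_insert_self _ _)) ha₄ (.cut (φ := eq c' c')
          (Pure.eqRefl (Finset.mem_insert_self _ _) _ _ _ _ (Finset.Subset.refl _)
            (Finset.Subset.refl _) (ha₅.insert_suc (hB (.eq _ _)))) ?_))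
        refine Derives.weaken (Γ := S₁.ant) (Δ := S₁.suc) (.hyp (Or.inr rfl)
          (((((ha.insert_var hΦ N).insert_ant (hB (.eq _ _))).insert_ant (hB (.eq _ _))).insert_ant
            (hB (.lt _ _))).insert_suc (hI _ _))) ?_ (Finset.Subset.refl _) ha₆
        intro φ hφ
        simp only [S₁, Finset.mem_insert] at hφ ⊢
        tauto
  have inner : Derives Φ (insert (N + 1) P) ((H ∪ {Sb}) ∪
      {S | ∃ θ : Subst, θ N = v (N + 1) ∧ (∀ p ∈ P, θ p = v p) ∧
        S = Sequent.subst θ ⟨insert (eq c c) Γ, insert (instBlk k σ c (above N)) Δ⟩}) S₁ := by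
    have ha₁ : S₁.Admissible Φ (insert (N + 1) P) :=
      (((((ha.insert_ant (hB (.eq _ _))).insert_var hΦ (N + 1)).insert_ant
        (hB (.eq _ _))).insert_ant (hB (.lt _ _))).insert_suc (hI _ _))
    refine .cut (φ := instBlk k σ (succ c') (above N)) ?_ ?_
    · refine Derives.weaken (h₁.graft ?_) ?_ ?_ (ha₁.insert_suc (hI _ _))
      -- A leaf that uses the hypothesis at c' contains Γ, c' = c' ⇒ Δ, σ(u, c'). This is the
      -- initial sequent of the cycle with c' for c and `u` for the generic arguments, so the path
      -- can return.
      · rintro ⟨Γ', Δ'⟩ ⟨k', σ', t', u, hU, hΓ', hΔ'⟩ ha'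
        rcases hU with e | hU
        · simp only [Prod.mk.injEq] at e
          obtain ⟨rfl, rfl, rfl⟩ := e
          refine Derives.weaken (Γ := insert (eq c' c') Γ) (Δ := insert (instBlk k' σ' c' u) Δ)
            (.hyp (Or.inr ⟨reassign N c' u, reassign_self, fun p hp => reassign_lt p (hP p hp),
              (hsub c' u).symm⟩) ((ha.insert_var hΦ (N + 1)).insert_suc (hI _ _))) hΓ' ?_ ha'
          exact (Finset.insert_subset_insert _ (Finset.subset_insert _ _)).trans hΔ'
        · exact .hyp (Or.inl (Or.inl ⟨k', σ', t', u, hU, (Finset.subset_insert _ _).trans hΓ',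
            (Finset.insert_subset_insert _ (Finset.subset_insert _ _)).trans hΔ'⟩)) ha'
      · intro φ hφ
        simp only [c', Finset.mem_insert] at hφ ⊢
        tauto
      · exact Finset.insert_subset_insert _ (Finset.subset_insert _ _)
    · exact Pure.replace hΦ (s := succ c') (t := c) (by simp) hσΦ (blkE _ c)
        (Finset.mem_insert_self _ _) (Finset.mem_insert_self _ _) _ _ _ _
        (Finset.Subset.refl _) (Finset.Subset.refl _) (ha₁.insert_ant (hI _ _))
  have cycle : Derives Φ P H ⟨insert (eq c c) Γ, insert (instBlk k σ c (above N)) Δ⟩ := by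
    refine (Derives.loop outer inner (Finset.mem_insert_self _ _)).graft ?_
    rintro T (hT | rfl) haT
    · exact .hyp hT haT
    · exact Derives.weaken (Derives.mono h₀ (leafSet_mono (Set.Subset.refl _) (Finset.Subset.refl _)
        (Finset.subset_insert _ _))) (Finset.subset_insert _ _) (Finset.Subset.refl _) haT
  -- As σ(u, s) is already in Δ, this instance of the cycle reads s = s, Γ ⇒ Δ, and the equation can
  -- be cut.
  have := cycle.subst hΦ (θ := reassign N s u) fun p hp => reassign_lt p (hP p hp)
  rw [hsub, insert_eq_self hs] at this
  exact .cut (Pure.eqRefl (t := s) (Finset.mem_insert_self _ _) _ _ _ _ (Finset.Subset.refl _)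
    (Finset.Subset.refl _) (ha.insert_suc (hB (.eq _ _)))) this

end DerivesFrom

/-! ## Countability of the syntax -/

instance : Countable (Σ k, arith.Functions k) := by
  let e : (Σ k, Func k) → ℕ := fun f => match f with
    | ⟨_, .zero⟩ => 0
    | ⟨_, .succ⟩ => 1
    | ⟨_, .add⟩ => 2
    | ⟨_, .mul⟩ => 3
  refine Function.Injective.countable (f := e) ?_
  rintro ⟨_, f⟩ ⟨_, g⟩ h
  cases f <;> cases g <;> first | rfl | simp [e] at h

instance : Countable Form := by
  obtain ⟨e, he⟩ := exists_injective_nat Tm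
  let enc : Form → ℕ := fun φ => φ.rec
    (fun s t => Nat.pair 0 (Nat.pair (e s) (e t)))
    (fun s t => Nat.pair 1 (Nat.pair (e s) (e t)))
    (fun s t => Nat.pair 2 (Nat.pair (e s) (e t)))
    (fun s t => Nat.pair 3 (Nat.pair (e s) (e t)))
    (fun _ _ m n => Nat.pair 4 (Nat.pair m n))
    (fun _ _ m n => Nat.pair 5 (Nat.pair m n))
    (fun _ m => Nat.pair 6 m)
    (fun _ m => Nat.pair 7 m)
  refine Function.Injective.countable (f := enc) ?_
  intro φ
  induction φ with
  | eq s t | neq s t | lt s t | nlt s t =>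
    intro ψ h
    cases ψ <;> simp only [enc, Nat.pair_eq_pair] at h <;> first | omega | skip
    rw [he h.2.1, he h.2.2]
  | and φ₁ φ₂ ih₁ ih₂ | or φ₁ φ₂ ih₁ ih₂ =>
    intro ψ h
    cases ψ <;> simp only [enc, Nat.pair_eq_pair] at h <;> first | omega | skip
    rw [ih₁ h.2.1, ih₂ h.2.2]
  | all φ ih | ex φ ih =>
    intro ψ h
    cases ψ <;> simp only [enc, Nat.pair_eq_pair] at h <;> first | omega | skip
    rw [ih h.2]

/-! ## Saturated pairs of sets of formulae -/

/-- `G` and `D` are the formulae in `Φ` that are true and false in some term model. -/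
structure Saturated (Φ G D : Set Form) : Prop where
  true_sub : G ⊆ Φ
  false_sub : D ⊆ Φ
  not_pure : ∀ Γ Δ : Finset Form, (∀ φ ∈ Γ, φ ∈ G) → (∀ φ ∈ Δ, φ ∈ D) → ¬ Pure Φ Γ Δ
  decides : ∀ φ ∈ Φ, φ ∈ G ∨ φ ∈ D
  witness_ex : ∀ φ, ex φ ∈ G → ∃ a, φ.inst (v a) ∈ G
  witness_all : ∀ φ, all φ ∈ D → ∃ a, φ.inst (v a) ∈ D

/-- An underivable sequent, with universal hypotheses. -/
structure Stage (Φ : Set Form) where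
  P : Finset ℕ
  U : Set (ℕ × Form × Tm)
  Γ : Finset Form
  Δ : Finset Form
  admissible : (⟨Γ, Δ⟩ : Sequent).Admissible Φ P
  not_derivable : ¬ DerivesFrom Φ P U Γ Δ

namespace Stage

variable {Φ : Set Form}

/-- The set `P` is not compared: it only restricts derivations, whereas the limit of the
construction collects `U`, `Γ` and `Δ`. -/
instance : Preorder (Stage Φ) :=
  Preorder.lift fun s => ((s.U, s.Γ, s.Δ) : Set (ℕ × Form × Tm) × Finset Form × Finset Form)

theorem le_iff {s s' : Stage Φ} : s ≤ s' ↔ s.U ⊆ s'.U ∧ s.Γ ⊆ s'.Γ ∧ s.Δ ⊆ s'.Δ := Iff.rfl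

/-- The formula `φ` is decided, with a witness. -/
def Decided (φ : Form) (s : Stage Φ) : Prop :=
  (φ ∈ s.Γ ∧ ∀ ψ, φ = ex ψ → ∃ a, ψ.inst (v a) ∈ s.Γ) ∨
    (φ ∈ s.Δ ∧ ∀ ψ, φ = all ψ → ∃ a, ψ.inst (v a) ∈ s.Δ)

/-- Either `(all^[k] σ).inst t` is assumed, or it has a counterexample and induction fails at zero or at
some successor step. -/
def Inductive (k : ℕ) (σ : Form) (t : Tm) (s : Stage Φ) : Prop :=
  (k, σ, t) ∈ s.U ∨ (∃ u, instBlk k σ t u ∈ s.Δ) ∧ ((∃ u, instBlk k σ zero u ∈ s.Δ) ∨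
    ∃ c, (k, σ, c) ∈ s.U ∧ ∃ u, instBlk k σ (succ c) u ∈ s.Δ)

/-- If `φ` could be added on neither side, a cut on `φ` would derive the stage. Adding a fresh
witness as well keeps it underivable, by the eigenvariable rules. -/
theorem exists_decided (hΦ : ClosedClass Φ) (s : Stage Φ) {φ : Form} (hφ : φ ∈ Φ) :
    ∃ s' ≥ s, Decided φ s' := by
  by_cases h : DerivesFrom Φ s.P s.U (insert φ s.Γ) s.Δ
  · have h' : ¬ DerivesFrom Φ s.P s.U s.Γ (insert φ s.Δ) := fun h' => s.not_derivable
      (.cut (φ := φ)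
        (h'.mono (leafSet_mono (Set.Subset.refl _) (Finset.Subset.refl _) (Finset.subset_insert _ _)))
        (h.mono (leafSet_mono (Set.Subset.refl _) (Finset.subset_insert _ _) (Finset.Subset.refl _))))
    have ha := s.admissible.insert_suc hφ
    by_cases e : ∃ ψ, φ = all ψ
    · obtain ⟨ψ, rfl⟩ := e
      obtain ⟨a, hf⟩ := exists_fresh ⟨s.Γ, insert (all ψ) s.Δ⟩
      refine ⟨⟨s.P, s.U, s.Γ, insert (ψ.inst (v a)) (insert (all ψ) s.Δ),
        ha.insert_suc (hΦ.subst (hΦ.all_body hφ) _), fun hd => h' ?_⟩,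
        le_iff.2 ⟨Set.Subset.refl _, Finset.Subset.refl _,
          (Finset.subset_insert _ _).trans (Finset.subset_insert _ _)⟩,
        Or.inr ⟨by simp, fun χ hχ => ?_⟩⟩
      · exact .allR (Finset.mem_insert_self _ _) hf (hd.mono (leafSet_mono (Set.Subset.refl _)
          (Finset.Subset.refl _) (Finset.subset_insert _ _)))
      · cases hχ
        exact ⟨a, by simp⟩
    · exact ⟨⟨s.P, s.U, s.Γ, insert φ s.Δ, ha, h'⟩,
        le_iff.2 ⟨Set.Subset.refl _, Finset.Subset.refl _, Finset.subset_insert _ _⟩,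
        Or.inr ⟨by simp, fun χ hχ => absurd ⟨χ, hχ⟩ e⟩⟩
  · have ha := s.admissible.insert_ant hφ
    by_cases e : ∃ ψ, φ = ex ψ
    · obtain ⟨ψ, rfl⟩ := e
      obtain ⟨a, hf⟩ := exists_fresh ⟨insert (ex ψ) s.Γ, s.Δ⟩
      refine ⟨⟨s.P, s.U, insert (ψ.inst (v a)) (insert (ex ψ) s.Γ), s.Δ,
        ha.insert_ant (hΦ.subst (hΦ.ex_body hφ) _), fun hd => h ?_⟩,
        le_iff.2 ⟨Set.Subset.refl _,
          (Finset.subset_insert _ _).trans (Finset.subset_insert _ _), Finset.Subset.refl _⟩,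
        Or.inl ⟨by simp, fun χ hχ => ?_⟩⟩
      · exact .exL (Finset.mem_insert_self _ _) ha hf (hd.mono (leafSet_mono (Set.Subset.refl _)
          (Finset.subset_insert _ _) (Finset.Subset.refl _)))
      · cases hχ
        exact ⟨a, by simp⟩
    · exact ⟨⟨s.P, s.U, insert φ s.Γ, s.Δ, ha, h⟩,
        le_iff.2 ⟨Set.Subset.refl _, Finset.subset_insert _ _, Finset.Subset.refl _⟩,
        Or.inl ⟨by simp, fun χ hχ => absurd ⟨χ, hχ⟩ e⟩⟩

theorem exists_below (P : Finset ℕ) (Γ Δ : Finset Form) (σ : Form) (t : Tm) :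
    ∃ N, (∀ p ∈ P, p < N) ∧ (∀ φ ∈ Γ, φ.Below N) ∧ (∀ φ ∈ Δ, φ.Below N) ∧ σ.Below N ∧
      ∀ x ∈ t.varFinset, x < N := by
  let F := P ∪ Γ.biUnion freeVars ∪ Δ.biUnion freeVars ∪ σ.freeVars ∪ t.varFinset
  have hF : ∀ x ∈ F, x < F.sup Nat.succ := fun x hx => Finset.le_sup (f := Nat.succ) hx
  refine ⟨F.sup Nat.succ, fun x hx => hF x ?_, fun φ hφ x hx => hF x ?_, fun φ hφ x hx => hF x ?_,
    fun x hx => hF x ?_, fun x hx => hF x ?_⟩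
  · simp [F, hx]
  · simp only [F, Finset.mem_union, Finset.mem_biUnion]
    exact Or.inl (Or.inl (Or.inl (Or.inr ⟨φ, hφ, hx⟩)))
  · simp only [F, Finset.mem_union, Finset.mem_biUnion]
    exact Or.inl (Or.inl (Or.inr ⟨φ, hφ, hx⟩))
  · simp [F, hx]
  · simp [F, hx]

/-- If assuming ∀x⃗ σ(x⃗, t) makes the sequent derivable, then by `cut_all` a generic instance σ(x⃗,
t) can be added on the right without making it so. `DerivesFrom.induction` then shows that the base
or the step of the induction is underivable, and that one becomes the new stage. -/
theorem exists_inductive (hΦ : ClosedClass Φ) (s : Stage Φ) (k : ℕ) {σ : Form} (hσ : σ ∈ Φ)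
    (t : Tm) : ∃ s' ≥ s, Inductive k σ t s' := by
  by_cases h : DerivesFrom Φ s.P (insert (k, σ, t) s.U) s.Γ s.Δ
  · obtain ⟨N, hP, hΓ, hΔ, hσN, ht⟩ := exists_below s.P s.Γ s.Δ σ t
    let Δ' := insert (instBlk k σ t (above N)) s.Δ
    have h' : ¬ DerivesFrom Φ s.P s.U s.Γ Δ' :=
      fun h' => s.not_derivable (DerivesFrom.cut_all hΦ hP hΓ hΔ hσN ht h h')
    have ha : (⟨s.Γ, Δ'⟩ : Sequent).Admissible Φ s.P := s.admissible.insert_suc (hΦ.subst hσ _)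
    -- The instance just added may have free variables above `N`, hence a second bound.
    obtain ⟨N', hP', hΓ', hΔ', hσN', -⟩ := exists_below s.P s.Γ Δ' σ t
    have hle : s.Δ ⊆ Δ' := Finset.subset_insert _ _
    by_cases h₀ : DerivesFrom Φ s.P s.U s.Γ (insert (instBlk k σ zero (above N')) Δ')
    · refine ⟨⟨insert (N' + 1) s.P, insert (k, σ, v (N' + 1)) s.U,
        insert (eq (v (N' + 1)) (v (N' + 1))) s.Γ,
        insert (instBlk k σ (succ (v (N' + 1))) (above N')) Δ',
        (ha.insert_var hΦ _).insert_suc (hΦ.subst hσ _), fun h₁ => h' ?_⟩,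
        le_iff.2 ⟨Set.subset_insert _ _, Finset.subset_insert _ _,
          hle.trans (Finset.subset_insert _ _)⟩, Or.inr ⟨⟨above N, by simp [Δ']⟩,
          Or.inr ⟨v (N' + 1), by simp, above N', by simp⟩⟩⟩
      exact DerivesFrom.induction hΦ hP' hΓ' hΔ' hσN' hσ h₀ h₁ (Finset.mem_insert_self _ _)
    · exact ⟨⟨s.P, s.U, s.Γ, insert (instBlk k σ zero (above N')) Δ',
        ha.insert_suc (hΦ.subst hσ _), h₀⟩,
        le_iff.2 ⟨Set.Subset.refl _, Finset.Subset.refl _, hle.trans (Finset.subset_insert _ _)⟩,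
        Or.inr ⟨⟨above N, by simp [Δ']⟩, Or.inl ⟨above N', Finset.mem_insert_self _ _⟩⟩⟩
  · exact ⟨⟨s.P, insert (k, σ, t) s.U, s.Γ, s.Δ, s.admissible, h⟩,
      le_iff.2 ⟨Set.subset_insert _ _, Finset.Subset.refl _, Finset.Subset.refl _⟩,
      Or.inl (Set.mem_insert _ _)⟩

end Stage

/-- An underivable sequent is falsified by a saturated pair that satisfies the induction principle
for the universal closures of formulae in `Φ`. -/
theorem exists_saturated {Φ : Set Form} (hΦ : ClosedClass Φ) (s₀ : Stage Φ) :
    ∃ (G D : Set Form) (U : Set (ℕ × Form × Tm)), Saturated Φ G D ∧ (∀ φ ∈ s₀.Δ, φ ∈ D) ∧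
      (∀ k σ t u, (k, σ, t) ∈ U → instBlk k σ t u ∉ D) ∧
      ∀ k σ t, σ ∈ Φ → (k, σ, t) ∈ U ∨ (∃ u, instBlk k σ t u ∈ D) ∧
        ((∃ u, instBlk k σ zero u ∈ D) ∨
          ∃ c, (k, σ, c) ∈ U ∧ ∃ u, instBlk k σ (succ c) u ∈ D) := by
  let T := Φ ⊕ ℕ × Φ × Tm
  have : Encodable T := Encodable.ofCountable T
  -- The countably many tasks: to decide a formula, and to treat induction for a triple (k, σ, t).
  -- Each can be fulfilled beyond any stage.
  let C : T → Order.Cofinal (Stage Φ) := Sum.elim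
    (fun φ => ⟨{s | s.Decided φ}, fun s =>
      let ⟨s', h, h'⟩ := s.exists_decided hΦ φ.2; ⟨s', h', h⟩⟩)
    fun x => ⟨{s | s.Inductive x.1 x.2.1 x.2.2}, fun s =>
      let ⟨s', h, h'⟩ := s.exists_inductive hΦ x.1 x.2.1.2 x.2.2; ⟨s', h', h⟩⟩
  let f := Order.sequenceOfCofinals s₀ C
  have hf : Monotone f := Order.sequenceOfCofinals.monotone s₀ C
  have hC : ∀ x, ∃ n, f n ∈ C x := fun x => ⟨_, Order.sequenceOfCofinals.encode_mem s₀ C x⟩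
  have hU : ∀ {m n}, m ≤ n → (f m).U ⊆ (f n).U := fun h => (Stage.le_iff.1 (hf h)).1
  have hΓ : ∀ {m n}, m ≤ n → (f m).Γ ⊆ (f n).Γ := fun h => (Stage.le_iff.1 (hf h)).2.1
  have hΔ : ∀ {m n}, m ≤ n → (f m).Δ ⊆ (f n).Δ := fun h => (Stage.le_iff.1 (hf h)).2.2
  have fin : ∀ (g : ℕ → Finset Form), (∀ {m n}, m ≤ n → g m ⊆ g n) → ∀ F : Finset Form,
      (∀ φ ∈ F, ∃ n, φ ∈ g n) → ∃ n, F ⊆ g n := by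
    intro g hg F
    induction F using Finset.induction_on with
    | empty => exact fun _ => ⟨0, Finset.empty_subset _⟩
    | insert φ F _ ih =>
      intro h
      obtain ⟨m, hm⟩ := ih fun ψ hψ => h ψ (Finset.mem_insert_of_mem hψ)
      obtain ⟨n, hn⟩ := h φ (Finset.mem_insert_self _ _)
      exact ⟨max m n, Finset.insert_subset (hg (le_max_right _ _) hn)
        (hm.trans (hg (le_max_left _ _)))⟩
  refine ⟨{φ | ∃ n, φ ∈ (f n).Γ}, {φ | ∃ n, φ ∈ (f n).Δ}, {x | ∃ n, x ∈ (f n).U}, ?_, ?_, ?_, ?_⟩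
  · constructor
    · rintro φ ⟨n, hn⟩
      exact (f n).admissible.mem_of_ant hn
    · rintro φ ⟨n, hn⟩
      exact (f n).admissible.mem_of_suc hn
    · intro Γ Δ h₁ h₂ hp
      obtain ⟨m, hm⟩ := fin (fun n => (f n).Γ) hΓ Γ h₁
      obtain ⟨n, hn⟩ := fin (fun n => (f n).Δ) hΔ Δ h₂
      exact (f (max m n)).not_derivable (hp _ _ _ _ (hm.trans (hΓ (le_max_left _ _)))
        (hn.trans (hΔ (le_max_right _ _))) (f (max m n)).admissible)
    · intro φ hφ
      obtain ⟨n, hn⟩ := hC (Sum.inl ⟨φ, hφ⟩)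
      exact Or.imp (fun h => ⟨n, h.1⟩) (fun h => ⟨n, h.1⟩) hn
    · rintro φ ⟨m, hm⟩
      obtain ⟨n, h | h⟩ := hC (Sum.inl ⟨_, (f m).admissible.mem_of_ant hm⟩)
      · obtain ⟨a, ha⟩ := h.2 φ rfl
        exact ⟨a, n, ha⟩
      -- Decided on the other side, the formula would make some stage an initial sequent.
      · exact absurd (Pure.id (φ := ex φ) (hΓ (le_max_left m n) hm) (hΔ (le_max_right m n) h.1)
          _ _ _ _ (Finset.Subset.refl _) (Finset.Subset.refl _) (f (max m n)).admissible)
          (f (max m n)).not_derivable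
    · rintro φ ⟨m, hm⟩
      obtain ⟨n, h | h⟩ := hC (Sum.inl ⟨_, (f m).admissible.mem_of_suc hm⟩)
      · exact absurd (Pure.id (φ := all φ) (hΓ (le_max_right m n) h.1) (hΔ (le_max_left m n) hm)
          _ _ _ _ (Finset.Subset.refl _) (Finset.Subset.refl _) (f (max m n)).admissible)
          (f (max m n)).not_derivable
      · obtain ⟨a, ha⟩ := h.2 φ rfl
        exact ⟨a, n, ha⟩
  · exact fun φ hφ => ⟨0, hφ⟩
  · rintro k σ t u ⟨m, hm⟩ ⟨n, hn⟩
    -- A stage with an instance of one of its universal hypotheses on the right would itself be an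
    -- open leaf.
    refine (f (max m n)).not_derivable (.hyp ⟨k, σ, t, u, hU (le_max_left _ _) hm,
      Finset.Subset.refl _, ?_⟩ (f (max m n)).admissible)
    rw [insert_eq_self (hΔ (le_max_right _ _) hn)]
  · intro k σ t hσ
    obtain ⟨n, hn⟩ := hC (Sum.inr (k, ⟨σ, hσ⟩, t))
    rcases hn with h | ⟨⟨u, hu⟩, ⟨u', hu'⟩ | ⟨c, hc, u', hu'⟩⟩
    · exact Or.inl ⟨n, h⟩
    · exact Or.inr ⟨⟨u, n, hu⟩, Or.inl ⟨u', n, hu'⟩⟩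
    · exact Or.inr ⟨⟨u, n, hu⟩, Or.inr ⟨c, ⟨n, hc⟩, u', n, hu'⟩⟩

/-! ## The term model of a saturated pair -/

namespace Saturated

variable {Φ G D : Set Form} (h : Saturated Φ G D)
include h

theorem not_mem_false {φ : Form} (hφ : φ ∈ G) : φ ∉ D := fun hφ' =>
  h.not_pure {φ} {φ} (by simpa) (by simpa) (Pure.id (φ := φ) (by simp) (by simp))

theorem mem_of_pure {Γ : Finset Form} {φ : Form} (hφ : φ ∈ Φ) (hΓ : ∀ ψ ∈ Γ, ψ ∈ G)
    (hp : Pure Φ Γ {φ}) : φ ∈ G :=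
  (h.decides φ hφ).resolve_right fun hφ' => h.not_pure Γ {φ} hΓ (by simpa) hp

theorem neg_mem_iff {φ : Form} (hφ : φ ∈ Φ) (hφ' : φ.neg ∈ Φ) : φ.neg ∈ G ↔ φ ∉ G := by
  constructor
  · intro h₁ h₂
    exact h.not_pure {φ, φ.neg} ∅ (by simp [h₁, h₂]) (by simp)
      (Pure.negL (φ := φ) (by simp) (by simp))
  · intro h₁
    have h₂ := (h.decides φ hφ).resolve_left h₁
    refine (h.decides _ hφ').resolve_right fun h₃ => ?_
    exact h.not_pure ∅ {φ, φ.neg} (by simp) (by simp [h₂, h₃])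
      (Pure.negR (φ := φ) (by simp) (by simp))

variable (hΦ : ClosedClass Φ)
include hΦ

theorem mem_eq_of_pure {Γ : Finset Form} {s t : Tm} (hΓ : ∀ ψ ∈ Γ, ψ ∈ G)
    (hp : Pure Φ Γ {eq s t}) : eq s t ∈ G :=
  h.mem_of_pure (hΦ.bounded (.eq _ _)) hΓ hp

/-- Provable equality of terms. -/
def setoid : Setoid Tm where
  r s t := eq s t ∈ G
  iseqv :=
    { refl := fun t => h.mem_eq_of_pure hΦ (Γ := ∅) (by simp) (Pure.eqRefl (t := t) (by simp))
      symm := fun {s t} hst => h.mem_eq_of_pure hΦ (Γ := {eq s t}) (by simpa)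
        (Pure.symm hΦ (s := s) (t := t) (by simp) (by simp))
      trans := fun {s t u} hst htu => h.mem_eq_of_pure hΦ (Γ := {eq s t, eq t u})
        (by simp [hst, htu]) (Pure.trans hΦ (s := s) (t := t) (u := u) (by simp) (by simp) (by simp)) }

def Model : Type := Quotient (h.setoid hΦ)

def cls (t : Tm) : h.Model hΦ := Quotient.mk (h.setoid hΦ) t

theorem cls_eq_iff {s t : Tm} : h.cls hΦ s = h.cls hΦ t ↔ eq s t ∈ G :=
  Quotient.eq (r := h.setoid hΦ)

theorem eq_out_mem (t : Tm) : eq (h.cls hΦ t).out t ∈ G :=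
  (h.cls_eq_iff hΦ).1 (Quotient.out_eq _)

theorem exists_cls (a : h.Model hΦ) : ∃ t, h.cls hΦ t = a := Quotient.exists_rep a

/-- The operations use chosen representatives; `funMap_cls` and `relMap_cls` show that the choice is
immaterial. -/
noncomputable instance : arith.Structure (h.Model hΦ) where
  funMap f xs := h.cls hΦ (Term.func f fun i => (xs i).out)
  RelMap {k} R xs := match k, R, xs with
    | _, Pred.lt, xs => lt (xs 0).out (xs 1).out ∈ G

theorem funMap_cls {k : ℕ} (f : arith.Functions k) (ts : Fin k → Tm) :
    Structure.funMap f (fun i => h.cls hΦ (ts i)) = h.cls hΦ (Term.func f ts) := by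
  refine (h.cls_eq_iff hΦ).2 (h.mem_eq_of_pure hΦ
    (Γ := Finset.univ.image fun i => eq (h.cls hΦ (ts i)).out (ts i)) ?_ ?_)
  · intro ψ hψ
    obtain ⟨i, -, rfl⟩ := Finset.mem_image.1 hψ
    exact h.eq_out_mem hΦ _
  · exact Pure.eqFunc (f := f) (fun i => Finset.mem_image_of_mem _ (Finset.mem_univ i)) (by simp)

theorem relMap_cls (s t : Tm) : Structure.RelMap (L := arith) (M := h.Model hΦ) Pred.lt
    ![h.cls hΦ s, h.cls hΦ t] ↔ lt s t ∈ G := by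
  have e : ∀ {s t s' t'}, eq s s' ∈ G → eq t t' ∈ G → lt s t ∈ G → lt s' t' ∈ G := by
    intro s t s' t' h₁ h₂ h₃
    exact h.mem_of_pure (Γ := {eq s s', eq t t', lt s t}) (hΦ.bounded (.lt _ _))
      (by simp [h₁, h₂, h₃])
      (Pure.eqLt (s₁ := s) (s₂ := t) (t₁ := s') (t₂ := t') (by simp) (by simp) (by simp) (by simp))
  change lt (h.cls hΦ s).out (h.cls hΦ t).out ∈ G ↔ _
  exact ⟨e (h.eq_out_mem hΦ s) (h.eq_out_mem hΦ t),
    e ((h.setoid hΦ).symm (h.eq_out_mem hΦ s)) ((h.setoid hΦ).symm (h.eq_out_mem hΦ t))⟩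

/-- The assignment of the class of `θ n` to the variable `n`. -/
def assign (θ : Subst) : ℕ → h.Model hΦ := fun n => h.cls hΦ (θ n)

theorem exists_assign (ρ : ℕ → h.Model hΦ) : ∃ θ, h.assign hΦ θ = ρ := by
  choose θ hθ using fun n => h.exists_cls hΦ (ρ n)
  exact ⟨θ, funext hθ⟩

theorem realize_assign (t : Tm) (θ : Subst) :
    t.realize (h.assign hΦ θ) = h.cls hΦ (t.subst θ) := by
  induction t with
  | var n => rfl
  | func f ts ih =>
    rw [Term.realize_func]
    simp only [ih, funMap_cls]
    rfl

/-- The truth lemma. -/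
theorem sat_iff {φ : Form} (hφ : φ ∈ Φ) : φ.Sat (h.assign hΦ v) ↔ φ ∈ G := by
  -- The induction is on size because the quantifier cases concern instances, which are not
  -- subformulae but are smaller.
  obtain ⟨n, hn⟩ : ∃ n, φ.size < n := ⟨_, Nat.lt_succ_self _⟩
  induction n generalizing φ with
  | zero => omega
  | succ n ih =>
    cases φ with
    | eq s t => simp only [Sat, realize_assign, cls_eq_iff, tm_subst_v]
    | lt s t => simp only [Sat, realize_assign, relMap_cls, tm_subst_v]
    | neq s t =>
      simp only [Sat, realize_assign, tm_subst_v, ne_eq, cls_eq_iff]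
      exact (h.neg_mem_iff (φ := eq s t) (hΦ.bounded (.eq _ _)) hφ).symm
    | nlt s t =>
      simp only [Sat, realize_assign, tm_subst_v, relMap_cls]
      exact (h.neg_mem_iff (φ := lt s t) (hΦ.bounded (.lt _ _)) hφ).symm
    | and φ ψ =>
      simp only [size] at hn
      have h₁ := hΦ.and_left hφ
      have h₂ := hΦ.and_right hφ
      simp only [Sat]
      rw [ih h₁ (by omega), ih h₂ (by omega)]
      constructor
      · rintro ⟨h₃, h₄⟩
        exact h.mem_of_pure (Γ := {φ, ψ}) hφ (by simp [h₃, h₄]) (Pure.andR hΦ (φ := φ) (ψ := ψ)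
          (by simp) (Pure.id (φ := φ) (by simp) (by simp)) (Pure.id (φ := ψ) (by simp) (by simp)))
      · intro h₃
        exact ⟨h.mem_of_pure (Γ := {φ.and ψ}) h₁ (by simpa) (Pure.andL hΦ (φ := φ) (ψ := ψ)
            (by simp) (Pure.id (φ := φ) (by simp) (by simp))),
          h.mem_of_pure (Γ := {φ.and ψ}) h₂ (by simpa) (Pure.andL hΦ (φ := φ) (ψ := ψ)
            (by simp) (Pure.id (φ := ψ) (by simp) (by simp)))⟩
    | or φ ψ =>
      simp only [size] at hn
      have h₁ := hΦ.or_left hφ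
      have h₂ := hΦ.or_right hφ
      simp only [Sat]
      rw [ih h₁ (by omega), ih h₂ (by omega)]
      constructor
      · rintro (h₃ | h₃)
        · exact h.mem_of_pure (Γ := {φ}) hφ (by simpa) (Pure.orR hΦ (φ := φ) (ψ := ψ)
            (by simp) (Pure.id (φ := φ) (by simp) (by simp)))
        · exact h.mem_of_pure (Γ := {ψ}) hφ (by simpa) (Pure.orR hΦ (φ := φ) (ψ := ψ)
            (by simp) (Pure.id (φ := ψ) (by simp) (by simp)))
      · intro h₃
        by_contra! h₄
        exact h.not_pure {φ.or ψ} {φ, ψ} (by simpa) (by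
          simp [(h.decides _ h₁).resolve_left h₄.1, (h.decides _ h₂).resolve_left h₄.2])
          (Pure.orL hΦ (φ := φ) (ψ := ψ) (by simp) (Pure.id (φ := φ) (by simp) (by simp))
            (Pure.id (φ := ψ) (by simp) (by simp)))
    | all φ =>
      simp only [size] at hn
      have hi : ∀ t, φ.inst t ∈ Φ := fun t => hΦ.subst (hΦ.all_body hφ) _
      have hs : ∀ t, φ.Sat (scons (h.cls hΦ t) (h.assign hΦ v)) ↔ φ.inst t ∈ G := by
        intro t
        rw [← ih (hi t) (by rw [inst, size_subst]; omega), sat_inst, realize_assign, tm_subst_v]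
      simp only [Sat]
      constructor
      · intro h₁
        refine (h.decides _ hφ).resolve_right fun h₂ => ?_
        obtain ⟨a, ha⟩ := h.witness_all φ h₂
        exact h.not_mem_false ((hs (v a)).1 (h₁ _)) ha
      · intro h₁ a
        obtain ⟨t, rfl⟩ := h.exists_cls hΦ a
        exact (hs t).2 (h.mem_of_pure (Γ := {all φ}) (hi t) (by simpa)
          (Pure.allL hΦ (φ := φ) (by simp) t (Pure.id (φ := φ.inst t) (by simp) (by simp))))
    | ex φ =>
      simp only [size] at hn
      have hi : ∀ t, φ.inst t ∈ Φ := fun t => hΦ.subst (hΦ.ex_body hφ) _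
      have hs : ∀ t, φ.Sat (scons (h.cls hΦ t) (h.assign hΦ v)) ↔ φ.inst t ∈ G := by
        intro t
        rw [← ih (hi t) (by rw [inst, size_subst]; omega), sat_inst, realize_assign, tm_subst_v]
      simp only [Sat]
      constructor
      · rintro ⟨a, ha⟩
        obtain ⟨t, rfl⟩ := h.exists_cls hΦ a
        exact h.mem_of_pure (Γ := {φ.inst t}) hφ (by simpa using (hs t).1 ha)
          (Pure.exR hΦ (φ := φ) (by simp) t (Pure.id (φ := φ.inst t) (by simp) (by simp)))
      · intro h₁
        obtain ⟨a, ha⟩ := h.witness_ex φ h₁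
        exact ⟨_, (hs (v a)).2 ha⟩

theorem sat_of_mem {φ : Form} (hφ : φ ∈ G) : φ.Sat (h.assign hΦ v) :=
  (h.sat_iff hΦ (h.true_sub hφ)).2 hφ

theorem not_sat_of_mem {φ : Form} (hφ : φ ∈ D) : ¬ φ.Sat (h.assign hΦ v) := fun hs =>
  h.not_mem_false ((h.sat_iff hΦ (h.false_sub hφ)).1 hs) hφ

theorem sat_subst_assign (φ : Form) (θ : Subst) :
    (φ.subst θ).Sat (h.assign hΦ v) ↔ φ.Sat (h.assign hΦ θ) := by
  rw [sat_subst]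
  simp only [realize_assign, tm_subst_v]
  rfl

end Saturated

/-! ## Arithmetic in structures -/

section Arithmetic

variable {M : Type} [arith.Structure M]

def zeroM (M : Type) [arith.Structure M] : M := Structure.funMap (L := arith) Func.zero ![]
def succM (a : M) : M := Structure.funMap (L := arith) Func.succ ![a]
def addM (a b : M) : M := Structure.funMap (L := arith) Func.add ![a, b]

theorem realize_v (n : ℕ) (ρ : ℕ → M) : (v n).realize ρ = ρ n := rfl

theorem realize_zero (ρ : ℕ → M) : zero.realize ρ = zeroM M := by
  simp only [zero, zeroM, Term.realize_func]; congr 1; funext i; exact i.elim0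

theorem realize_succ (t : Tm) (ρ : ℕ → M) : (succ t).realize ρ = succM (t.realize ρ) := by
  simp only [succ, succM, Term.realize_func]; congr 1; funext i; fin_cases i; rfl

theorem realize_add (s t : Tm) (ρ : ℕ → M) :
    (add s t).realize ρ = addM (s.realize ρ) (t.realize ρ) := by
  simp only [add, addM, Term.realize_func]; congr 1; funext i; fin_cases i <;> rfl

/-- Existential conclusions of the bounded axioms lose their bounds. The converse half of the
definition of `<` takes the witness as the value of its free variable. -/
theorem sat_qMatrix (hB : ∀ A, QBounded A → ∀ ρ : ℕ → M, A.Sat ρ) {A : Form} (hA : QMatrix A)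
    (ρ : ℕ → M) : A.Sat ρ := by
  cases hA with
  | q1 => exact hB _ .q1 ρ
  | q2 => exact hB _ .q2 ρ
  | q4 => exact hB _ .q4 ρ
  | q5 => exact hB _ .q5 ρ
  | q6 => exact hB _ .q6 ρ
  | q7 => exact hB _ .q7 ρ
  | q3 =>
    have := hB _ .q3 ρ
    rw [sat_imp] at this ⊢
    exact fun h => (this h).imp fun _ h => h.2
  | q8 =>
    refine ⟨?_, ?_⟩
    · have := hB _ .q8l ρ
      rw [sat_imp] at this ⊢
      exact fun h => (this h).imp fun _ h => h.2
    · rw [sat_imp]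
      rintro ⟨z, hz⟩
      have := hB _ .q8r (scons (ρ 0) (scons (ρ 1) (scons z ρ)))
      rw [sat_imp] at this
      refine this ?_
      simp only [Sat, realize_add, realize_succ, realize_v] at hz ⊢
      exact hz

theorem sat_inductionAxiom (φ : Form) (ρ : ℕ → M) : (inductionAxiom φ).Sat ρ ↔
    (φ.Sat (scons (zeroM M) ρ) → (∀ a, φ.Sat (scons a ρ) → φ.Sat (scons (succM a) ρ)) →
      ∀ a, φ.Sat (scons a ρ)) := by
  have e : ∀ a, (φ.subst (scons (succ (v 0)) fun n => v (n + 1))).Sat (scons a ρ) ↔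
      φ.Sat (scons (succM a) ρ) := by
    intro a
    rw [sat_subst]
    have : (fun n => (scons (succ (v 0)) (fun n => v (n + 1)) n).realize (scons a ρ)) =
        scons (succM a) ρ := by
      funext n
      cases n with
      | zero => exact realize_succ _ _
      | succ n => rfl
    rw [this]
  rw [inductionAxiom, sat_imp]
  simp only [Sat, sat_inst, sat_imp, e, realize_zero]
  exact and_imp

/-- Induction for `Πₙ₊₁` formulae entails induction for `Σₙ₊₁` formulae. -/
theorem sat_sigma_induction {n : ℕ} (hQ : ∀ A, QMatrix A → ∀ ρ : ℕ → M, A.Sat ρ)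
    (hI : ∀ (k : ℕ), ∀ σ ∈ SigmaClass n, ∀ ρ : ℕ → M, (inductionAxiom (all^[k] σ)).Sat ρ)
    {χ : Form} (hχ : χ ∈ SigmaClass (n + 1)) (ρ : ℕ → M) : (inductionAxiom χ).Sat ρ := by
  have hadd0 : ∀ a : M, addM a (zeroM M) = a := fun a => by
    have := hQ _ .q4 fun _ => a
    simpa only [Sat, realize_add, realize_zero, realize_v] using this
  have hadds : ∀ a b : M, addM a (succM b) = succM (addM a b) := fun a b => by
    have := hQ _ .q5 (scons a fun _ => b)
    simp only [Sat, realize_add, realize_succ, realize_v] at this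
    exact this
  -- This law and the next are not axioms of Q; they follow by induction for equations, with an
  -- empty quantifier block.
  have h0add : ∀ a : M, addM (zeroM M) a = a := by
    have := hI 0 (eq (add zero (v 0)) (v 0)) ((closedClass_sigma_pi n).1.bounded (.eq _ _)) ρ
    rw [sat_inductionAxiom] at this
    simp only [Function.iterate_zero, id, Sat, realize_add, realize_zero, realize_v] at this
    exact this (hadd0 _) fun a ha => (hadds _ _).trans (congrArg succM ha)
  have hsadd : ∀ b a : M, addM (succM b) a = succM (addM b a) := by
    intro b
    have := hI 0 (eq (add (succ (v 1)) (v 0)) (succ (add (v 1) (v 0))))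
      ((closedClass_sigma_pi n).1.bounded (.eq _ _)) (scons b ρ)
    rw [sat_inductionAxiom] at this
    simp only [Function.iterate_zero, id, Sat, realize_add, realize_succ, realize_v] at this
    refine this ?_ fun a ha => ?_
    · exact (hadd0 _).trans (congrArg succM (hadd0 b).symm)
    · exact (hadds _ _).trans ((congrArg succM ha).trans (congrArg succM (hadds b a).symm))
  rw [sat_inductionAxiom]
  intro h₀ h₁ a
  by_contra ha
  obtain ⟨k, π, hπ, rfl⟩ := mem_sigmaClass_succ.1 hχ
  -- Given χ(0), the step and ¬χ(a), induction on x is applied to ∀z (z + x = a ⊃ ¬χ(z)), with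
  -- matrix z + x ≠ a ∨ ¬π. There the variables below `k` are the block of π, then come z, x, a and,
  -- from `k + 3`, the parameters; `r` makes π skip x and a.
  let r : Subst := blk (k + 1) v fun j => v (k + 3 + j)
  obtain ⟨σ, hσ, hsat⟩ := (exists_equiv_or n).1 (neq (add (v k) (v (k + 1))) (v (k + 2)))
    (π.neg.subst r) (.neq _ _) ((closedClass_sigma_pi n).1.subst ((neg_mem_sigma_pi n).2 π hπ) r)
  have hr : ∀ (u : ℕ → M) (x : M), (fun i => (r i).realize (blk (k + 1) u (scons x (scons a ρ)))) =
      blk k u (scons (u k) ρ) := by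
    intro u x
    rw [← blk_succ]
    funext i
    by_cases hi : i < k + 1
    · simp only [r, blk_lt hi, realize_v]
    · obtain ⟨j, rfl⟩ := Nat.exists_eq_add_of_le (not_lt.1 hi)
      simp only [r, blk_add, realize_v]
      rw [show k + 3 + j = k + 1 + (j + 2) by omega, blk_add]
      rfl
  have key : ∀ x : M, (all^[k + 1] σ).Sat (scons x (scons a ρ)) ↔
      ∀ z, addM z x = a → ¬ (ex^[k] π).Sat (scons z ρ) := by
    intro x
    simp only [sat_all_iterate, hsat, sat_subst, hr, sat_neg, sat_ex_iterate, Sat, realize_add,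
      realize_v]
    have e₀ : ∀ u : ℕ → M, blk (k + 1) u (scons x (scons a ρ)) k = u k := fun u =>
      blk_lt k.lt_succ_self
    have e₁ : ∀ u : ℕ → M, blk (k + 1) u (scons x (scons a ρ)) (k + 1) = x := fun u =>
      blk_add (k + 1) 0 _ _
    have e₂ : ∀ u : ℕ → M, blk (k + 1) u (scons x (scons a ρ)) (k + 2) = a := fun u =>
      blk_add (k + 1) 1 _ _
    simp only [e₀, e₁, e₂]
    constructor
    · rintro hu z hz ⟨u, hπu⟩
      have := hu fun i => if i = k then z else u i
      simp only [if_true] at this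
      refine this.elim (fun h => h hz) fun h => h ?_
      convert hπu using 1
      funext i
      by_cases hi : i < k
      · rw [blk_lt hi, blk_lt hi, if_neg hi.ne]
      · obtain ⟨j, rfl⟩ := Nat.exists_eq_add_of_le (not_lt.1 hi)
        rw [blk_add, blk_add]
    · intro hz u
      by_cases h : addM (u k) x = a
      · exact Or.inr fun hπu => hz _ h ⟨u, hπu⟩
      · exact Or.inl h
  have ind := hI (k + 1) σ hσ (scons a ρ)
  rw [sat_inductionAxiom] at ind
  simp only [key] at ind
  -- At x = a the choice z = 0 contradicts χ(0). The base is ¬χ(a); in the step, z + s x = a gives s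
  -- z + x = a, hence ¬χ(s z) and so ¬χ(z).
  refine ind ?_ ?_ a (zeroM M) (h0add a) h₀
  · intro z hz
    rw [hadd0] at hz
    rwa [hz]
  · intro x hx z hz hχz
    refine hx (succM z) ?_ (h₁ z hχz)
    rw [hsadd, ← hadds, hz]

end Arithmetic

-- The term model satisfies IΣₙ₊₁, and the conclusion.

theorem QBounded.bounded {A : Form} (h : QBounded A) : Bounded A := by
  cases h with
  | q1 => exact .neq _ _
  | q2 => exact .or (.neq _ _) (.eq _ _)
  | q3 => exact .or (.eq _ _) (.bex _ (.eq _ _))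
  | q4 | q5 | q6 | q7 => exact .eq _ _
  | q8l => exact .or (.nlt _ _) (.bex _ (.eq _ _))
  | q8r => exact .or (.neq _ _) (.lt _ _)

namespace Saturated

variable {Φ G D : Set Form} (h : Saturated Φ G D) (hΦ : ClosedClass Φ)
include h hΦ

theorem sat_qBounded {A : Form} (hA : QBounded A) (ρ : ℕ → h.Model hΦ) : A.Sat ρ := by
  obtain ⟨θ, rfl⟩ := h.exists_assign hΦ ρ
  rw [← sat_subst_assign]
  exact h.sat_of_mem hΦ (h.mem_of_pure (Γ := ∅) (hΦ.bounded (hA.bounded.subst θ)) (by simp)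
    (Pure.ax hA (θ := θ) (by simp)))

theorem sat_instBlk (k : ℕ) (σ : Form) (t : Tm) (u : Subst) :
    (instBlk k σ t u).Sat (h.assign hΦ v) ↔
      σ.Sat (blk k (h.assign hΦ u) (scons (h.cls hΦ t) (h.assign hΦ v))) := by
  rw [instBlk, sat_subst_assign]
  have : h.assign hΦ (blk k u (scons t v)) =
      blk k (h.assign hΦ u) (scons (h.cls hΦ t) (h.assign hΦ v)) := by
    funext i
    simp only [assign, blk]
    split_ifs
    · rfl
    · cases i - k <;> rfl
  rw [this]

/-- Elements are classes of terms, so parameters can be substituted into σ and the induction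
variable is given by a term t. Either (k, σ, t) is in `U`, and the universal formula is true since
none of its instances is in `D`, or the base or a step fails. -/
theorem sat_induction {U : Set (ℕ × Form × Tm)}
    (hU : ∀ k σ t u, (k, σ, t) ∈ U → instBlk k σ t u ∉ D)
    (hI : ∀ k σ t, σ ∈ Φ → (k, σ, t) ∈ U ∨ (∃ u, instBlk k σ t u ∈ D) ∧
      ((∃ u, instBlk k σ zero u ∈ D) ∨
        ∃ c, (k, σ, c) ∈ U ∧ ∃ u, instBlk k σ (succ c) u ∈ D))
    (k : ℕ) {σ : Form} (hσ : σ ∈ Φ) (ρ : ℕ → h.Model hΦ) : (inductionAxiom (all^[k] σ)).Sat ρ := by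
  obtain ⟨θ, rfl⟩ := h.exists_assign hΦ ρ
  -- The terms for the parameters are renamed past the block and the induction variable.
  let σ' := σ.subst (blk (k + 1) v fun j => (θ j).relabel fun i => k + 1 + i)
  have hσ' : σ' ∈ Φ := hΦ.subst hσ _
  have e : ∀ (u : ℕ → h.Model hΦ) a, σ'.Sat (blk k u (scons a (h.assign hΦ v))) ↔
      σ.Sat (blk k u (scons a (h.assign hΦ θ))) := by
    intro u a
    let w : ℕ → h.Model hΦ := fun i => if i = k then a else u i
    have hw : ∀ ρ : ℕ → h.Model hΦ, blk k u (scons a ρ) = blk (k + 1) w ρ := by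
      intro ρ
      rw [blk_succ]
      simp only [w, if_true]
      funext i
      by_cases hi : i < k
      · rw [blk_lt hi, blk_lt hi, if_neg hi.ne]
      · obtain ⟨j, rfl⟩ := Nat.exists_eq_add_of_le (not_lt.1 hi)
        rw [blk_add, blk_add]
    rw [hw, hw, sat_subst]
    have : (fun i => (blk (k + 1) v (fun j => (θ j).relabel fun i => k + 1 + i) i).realize
        (blk (k + 1) w (h.assign hΦ v))) = blk (k + 1) w (h.assign hΦ θ) := by
      funext i
      by_cases hi : i < k + 1
      · rw [blk_lt hi, blk_lt hi, realize_v, blk_lt hi]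
      · obtain ⟨j, rfl⟩ := Nat.exists_eq_add_of_le (not_lt.1 hi)
        rw [blk_add, blk_add, Term.realize_relabel]
        have : (blk (k + 1) w (h.assign hΦ v) ∘ fun i => k + 1 + i) = h.assign hΦ v := by
          funext i; exact blk_add _ _ _ _
        rw [this, realize_assign, tm_subst_v]
        rfl
    rw [this]
  have true_of_mem : ∀ t, (k, σ', t) ∈ U →
      (all^[k] σ).Sat (scons (h.cls hΦ t) (h.assign hΦ θ)) := by
    intro t ht
    rw [sat_all_iterate]
    intro u
    obtain ⟨u, rfl⟩ := h.exists_assign hΦ u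
    rw [← e, ← sat_instBlk]
    exact h.sat_of_mem hΦ ((h.decides _ (hΦ.subst hσ' _)).resolve_right (hU _ _ _ _ ht))
  have false_of_mem : ∀ t u, instBlk k σ' t u ∈ D →
      ¬ (all^[k] σ).Sat (scons (h.cls hΦ t) (h.assign hΦ θ)) := by
    intro t u ht hs
    rw [sat_all_iterate] at hs
    refine h.not_sat_of_mem hΦ ht ?_
    rw [sat_instBlk, e]
    exact hs _
  have hzero : h.cls hΦ zero = zeroM _ := by
    have := realize_zero (h.assign hΦ v)
    rwa [realize_assign, tm_subst_v] at this
  have hsucc : ∀ t, h.cls hΦ (succ t) = succM (h.cls hΦ t) := by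
    intro t
    have := realize_succ t (h.assign hΦ v)
    rwa [realize_assign, realize_assign, tm_subst_v, tm_subst_v] at this
  rw [sat_inductionAxiom]
  intro h₀ h₁ a
  obtain ⟨t, rfl⟩ := h.exists_cls hΦ a
  rcases hI k σ' t hσ' with ht | ⟨-, ⟨u, hu⟩ | ⟨c, hc, u, hu⟩⟩
  · exact true_of_mem t ht
  · rw [← hzero] at h₀
    exact absurd h₀ (false_of_mem _ u hu)
  · have := h₁ _ (true_of_mem c hc)
    rw [← hsucc] at this
    exact absurd this (false_of_mem _ u hu)

end Saturated

/-- A sequent with formulae in `Σₙ` is the conclusion of a cyclic proof if `IΣₙ₊₁` proves it. -/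
theorem derives_of_proves {n : ℕ} {k : ℕ} {σ : Form} (hσ : σ ∈ SigmaClass n)
    (hp : Proves (ISigma (n + 1)) (all^[k] σ)) : Derives (SigmaClass n) ∅ ∅ ⟨∅, {σ}⟩ := by
  have hΦ := (closedClass_sigma_pi n).1
  by_contra hd
  -- Without universal hypotheses no leaf may stay open, so underivability of ⇒ σ gives an initial
  -- stage.
  have he : leafSet ∅ (∅ : Finset Form) {σ} = ∅ := by
    ext S; simp [leafSet]
  obtain ⟨G, D, U, h, hD, hU, hI⟩ := exists_saturated hΦ
    { P := ∅, U := ∅, Γ := ∅, Δ := {σ}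
      admissible := ⟨by simp, by simpa using hσ⟩
      not_derivable := by rwa [DerivesFrom, he] : Stage (SigmaClass n) }
  have hQ : ∀ A, QMatrix A → ∀ ρ : ℕ → h.Model hΦ, A.Sat ρ := fun A hA ρ =>
    sat_qMatrix (fun _ hB => h.sat_qBounded hΦ hB) hA ρ
  have hs := hp (h.Model hΦ) (by
    rintro _ (⟨A, hA, rfl⟩ | ⟨χ, hχ, rfl⟩)
    · exact sat_closure.2 (hQ A hA)
    · exact sat_closure.2 (sat_sigma_induction hQ
        (fun k σ hσ => h.sat_induction hΦ hU hI k hσ) hχ)) fun i => h.assign hΦ v (k + i)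
  refine h.not_sat_of_mem hΦ (hD σ (Finset.mem_singleton_self σ)) ?_
  -- The formula was evaluated at the canonical assignment shifted by `k`; instantiating the block
  -- with its first `k` values restores that assignment, under which σ is false.
  convert (sat_all_iterate _ _ _).1 hs (h.assign hΦ v) using 1
  funext i
  by_cases hi : i < k
  · rw [blk_lt hi]
  · obtain ⟨j, rfl⟩ := Nat.exists_eq_add_of_le (not_lt.1 hi)
    rw [blk_add]

theorem sat_toForm_singleton {M : Type} [arith.Structure M] {φ : Form} {ρ : ℕ → M}
    (h : (Sequent.toForm ⟨∅, {φ}⟩).Sat ρ) : φ.Sat ρ := by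
  simpa [Sequent.toForm, Sequent.disj, Sat] using h

end CyclicArith

theorem mainTheorem1 (n : ℕ) (φ : CyclicArith.Form) (hφ : φ ∈ CyclicArith.PiClass (n + 1))
    (h : CyclicArith.Proves (CyclicArith.ISigma (n + 1)) φ) :
    CyclicArith.Proves (CyclicArith.CSigma n) φ := by
  obtain ⟨k, σ, hσ, rfl⟩ := CyclicArith.mem_piClass_succ.1 hφ
  intro M _ hM ρ
  rw [CyclicArith.Form.sat_all_iterate]
  intro u
  exact CyclicArith.sat_toForm_singleton (CyclicArith.Form.sat_closure.1
    (hM _ (CyclicArith.derives_of_proves hσ h).closure_mem) _)
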